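/- A strict partition is a strictly decreasing sequence $\lambda=(\lambda_1>\dots>\lambda_\ell>0)$ of positive integers; its shifted diagram is $\widetilde\lambda=\{(i,j): 1\le i\le \ell,\ i\le j\le i+\lambda_i-1\}$ (rows $i$ from top to bottom, columns $j$ from left to right). For strict partitions $\mu\subseteq\lambda$, a marked shifted tableau of shape $\widetilde{\lambda/\mu}=\widetilde\lambda\setminus\widetilde\mu$ is a filling of the boxes with letters of the ordered alphabet $1'<1<2'<2<\cdots$ such that rows (left to right) and columns (top to bottom) are weakly increasing, each column contains at most one $a$ and each row contains at most one $a'$ for every $a\ge 1$. The skew Schur $Q$-function is $Q_{\lambda/\mu}=\sum_T\prod_i x_i^{c_i(T)}\in\mathbb{Q}[[x_1,x_2,\dots]]$, where $T$ runs over these tableaux and $c_i(T)$ is the number of entries of $T$ equal to $i$ or $i'$. For integers $1\le k\le n$ let $\mathfrak{r}_{\triangle_{n,k}}=Q_{\lambda/\mu}$ with $\lambda=(n,n-1,\dots,n-k+1)$ and $\mu=(n-1,n-2,\dots,n-k+1)$ (with $\mu=\emptyset$ if $k=1$). A symmetric function is called $p$-positive if it is a finite linear combination, with nonnegative rational coefficients,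 of the power sum symmetric functions $p_\nu=\prod_i p_{\nu_i}$, where $\nu$ ranges over partitions and $p_r=\sum_i x_i^r$. Theorem. Let $n$ and $k$ be positive integers with $k\le n$. (a) If $n\le 2$, then $\mathfrak{r}_{\triangle_{n,k}}$ is $p$-positive. (b) If $n\ge 3$ is odd, then $\mathfrak{r}_{\triangle_{n,k}}$ is $p$-positive if and only if $k\in\{1,3,n-2,n\}$. (c) If $n\ge 4$ is even, then $\mathfrak{r}_{\triangle_{n,k}}$ is $p$-positive if and only if $k\in\{1,3,n/2,n/2+1,n-2,n\}$. -/

import Mathlib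

/-- A strict partition: a strictly decreasing list of positive integers. -/
structure StrictPartition where
  parts : List ℕ
  sorted : parts.Pairwise (· > ·)
  pos : ∀ a ∈ parts, 0 < a

namespace StrictPartition

/-- The shifted diagram of a strict partition; rows and columns are numbered from `0`, so that
row `i` consists of the boxes `(i, j)` with `i ≤ j < i + lam_i`. -/
def shiftedDiagram (lam : StrictPartition) : Finset (ℕ × ℕ) :=
  (Finset.range lam.parts.length).biUnion fun i =>
    (Finset.Ico i (i + lam.parts.getD i 0)).image (Prod.mk i)

/-- The shifted skew diagram of `lam / mu` (used when `mu ⊆ lam`). -/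
def shiftedSkewDiagram (lam mu : StrictPartition) : Finset (ℕ × ℕ) :=
  lam.shiftedDiagram \ mu.shiftedDiagram

/-- The strict partition `(a, a - 1, …, a - l + 1)` with `l ≤ a` parts. -/
def consecutive (a l : ℕ) (h : l ≤ a) : StrictPartition where
  parts := (List.range l).map (fun i => a - i)
  sorted := by
    rw [List.pairwise_map]
    refine List.Pairwise.imp_of_mem ?_ List.pairwise_lt_range
    intro x y hx hy hxy
    rw [List.mem_range] at hx hy
    omega
  pos := by
    intro b hb
    obtain ⟨i, hi, rfl⟩ := List.mem_map.1 hb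
    rw [List.mem_range] at hi
    omega

theorem mem_shiftedDiagram_consecutive (a l : ℕ) (h : l ≤ a) (i j : ℕ) :
    (i, j) ∈ (consecutive a l h).shiftedDiagram ↔ i < l ∧ i ≤ j ∧ j < a := by
  simp only [shiftedDiagram, consecutive, Finset.mem_biUnion, Finset.mem_range, List.length_map,
    List.length_range, Finset.mem_image, Finset.mem_Ico, Prod.mk.injEq]
  constructor
  · rintro ⟨i', hi', j', hj', rfl, rfl⟩
    simp [hi'] at hj'
    omega
  · rintro ⟨h1, h2, h3⟩
    refine ⟨i, h1, j, ?_, rfl, rfl⟩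
    simp [h1]
    omega

end StrictPartition

/-- The alphabet `1' < 1 < 2' < 2 < ⋯` in lexicographic order: `(i, false)` is the marked letter
and `(i, true)` the unmarked letter belonging to the variable `x i`, where the variables are
numbered from `0`. -/
abbrev MarkedLetter : Type := ℕ ×ₗ Bool

namespace MarkedLetter

/-- The unmarked version `|a|` of a letter, as the index of its variable. -/
def index (a : MarkedLetter) : ℕ := (ofLex a).1

/-- The letter is marked. -/
def IsMarked (a : MarkedLetter) : Prop := (ofLex a).2 = false

end MarkedLetter

/-- Marked shifted tableaux on a set `D` of boxes `(row, column)`. -/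
structure MarkedShiftedTableau (D : Finset (ℕ × ℕ)) where
  entry : D → MarkedLetter
  row_weak : ∀ b c : D, b.1.1 = c.1.1 → b.1.2 ≤ c.1.2 → entry b ≤ entry c
  col_weak : ∀ b c : D, b.1.2 = c.1.2 → b.1.1 ≤ c.1.1 → entry b ≤ entry c
  col_unmarked : ∀ b c : D, b.1.2 = c.1.2 → entry b = entry c → ¬ (entry b).IsMarked → b = c
  row_marked : ∀ b c : D, b.1.1 = c.1.1 → entry b = entry c → (entry b).IsMarked → b = c

namespace MarkedShiftedTableau

/-- The content of a tableau: `i` is sent to the number of entries `a` with `|a| = i`. -/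
noncomputable def content {D : Finset (ℕ × ℕ)} (T : MarkedShiftedTableau D) : ℕ →₀ ℕ :=
  ∑ b : D, Finsupp.single (T.entry b).index 1

/-- There are only finitely many tableaux of a given content, so that counting them with
`Nat.card` below is meaningful. -/
theorem finite_content_eq (D : Finset (ℕ × ℕ)) (d : ℕ →₀ ℕ) :
    Finite {T : MarkedShiftedTableau D // T.content = d} := by
  have key : ∀ (T : {T : MarkedShiftedTableau D // T.content = d}) (b : D),
      (T.1.entry b).index ∈ d.support := by
    rintro ⟨T, rfl⟩ b
    have h1 : (Finsupp.single (T.entry b).index 1 : ℕ →₀ ℕ) ≤ T.content :=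
      Finset.single_le_sum (f := fun b : D => (Finsupp.single (T.entry b).index 1 : ℕ →₀ ℕ))
        (fun _ _ => bot_le) (Finset.mem_univ b)
    have h2 := h1 (T.entry b).index
    rw [Finsupp.single_eq_same] at h2
    rw [Finsupp.mem_support_iff]
    show T.content (T.entry b).index ≠ 0
    omega
  let F : {T : MarkedShiftedTableau D // T.content = d} → (D → d.support × Bool) :=
    fun T b => (⟨(T.1.entry b).index, key T b⟩, (ofLex (T.1.entry b)).2)
  refine Finite.of_injective F ?_
  rintro ⟨⟨e, _, _, _, _⟩, hT⟩ ⟨⟨e', _, _, _, _⟩, hT'⟩ hF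
  have : e = e' := by
    funext b
    have hb := congrFun hF b
    simp only [F, Prod.mk.injEq, Subtype.mk.injEq] at hb
    exact ofLex.injective (Prod.ext hb.1 hb.2)
  subst this
  rfl

end MarkedShiftedTableau

/-- The skew Schur `Q`-function `Q_{lam / mu} = ∑_T x ^ (content of T)`, as a formal power series
in the countably many variables `x 0, x 1, …`. -/
noncomputable def skewSchurQ (lam mu : StrictPartition) : MvPowerSeries ℕ ℚ := fun d =>
  (Nat.card {T : MarkedShiftedTableau (lam.shiftedSkewDiagram mu) // T.content = d} : ℚ)

open Classical in
/-- The power sum `p_r = ∑_i (x i) ^ r`, for `r ≥ 1`. -/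
noncomputable def powerSum (r : ℕ) : MvPowerSeries ℕ ℚ := fun d =>
  if ∃ i, d = Finsupp.single i r then 1 else 0

/-- The power sum symmetric function `p_nu = p_{nu_1} p_{nu_2} ⋯` of a partition `nu`. -/
noncomputable def powerSumPartition {m : ℕ} (nu : m.Partition) : MvPowerSeries ℕ ℚ :=
  (nu.parts.map powerSum).prod

/-- `f` is a finite linear combination of power sum symmetric functions `p_nu` (where `nu` runs
over the partitions of all natural numbers) with nonnegative rational coefficients. -/
def IsPPositive (f : MvPowerSeries ℕ ℚ) : Prop :=
  ∃ c : (Σ m : ℕ, m.Partition) →₀ ℚ,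
    (∀ nu, 0 ≤ c nu) ∧ f = c.sum fun nu a => a • powerSumPartition nu.2

/-- The ribbon Schur `Q`-function of `△_{n,k}`, that is `Q_{lam / mu}` for
`lam = (n, n - 1, …, n - k + 1)` and `mu = (n - 1, …, n - k + 1)`
(with `mu` empty if `k = 1`). -/
noncomputable def ribbonTriangle (n k : ℕ) (h : k ≤ n) : MvPowerSeries ℕ ℚ :=
  skewSchurQ (StrictPartition.consecutive n k h)
    (StrictPartition.consecutive (n - 1) (k - 1) (Nat.sub_le_sub_right h 1))

/-- The boxes of `△_{n,k}`: the last column, down to row `k - 1`, together with the row `k - 1`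
(rows and columns being numbered from `0`). -/
theorem mem_triangle_diagram (n k : ℕ) (hk : 1 ≤ k) (h : k ≤ n) (i j : ℕ) :
    (i, j) ∈ (StrictPartition.consecutive n k h).shiftedSkewDiagram
        (StrictPartition.consecutive (n - 1) (k - 1) (Nat.sub_le_sub_right h 1)) ↔
      (i < k ∧ j = n - 1) ∨ (i = k - 1 ∧ k - 1 ≤ j ∧ j < n) := by
  simp only [StrictPartition.shiftedSkewDiagram, Finset.mem_sdiff,
    StrictPartition.mem_shiftedDiagram_consecutive]
  omega

/-! The diagram of △_{n,k} is a hook: a row of n-k+1 boxes and a column of k boxes sharing the lower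
right corner. Read along the row and then up the column, a tableau is a word that rises, then does
not rise, where "rise" (`letterRel true`) and "non-rise" (`letterRel false` reversed) are
complementary. Let q_a be the Q-function of a row of length a; a column gives the same function.
Concatenating a row word and a column word and comparing the two letters at the junction gives
q_{n-k} q_k = r_{n,k} + r_{n,k+1} for 1 ≤ k < n. Hence r_{n,k+1} is the alternating sum of the q_j
q_{n-j} over j ≤ k.

Next, ∑ q_n t^n = exp(∑ 2 p_r t^r / r), with r odd. For a partition ν of n, the coefficient of p_ν
in q_k q_{n-k} is therefore a positive number (the coefficient of p_ν in h_n) times the coefficient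
of x^k in P_ν = ∏ w(1 + x^{ν_i}), where w is 2 for odd parts and 0 for even ones. The alternating
sum divides P_ν by 1 + x. As the power sums are algebraically independent, r_{n,k+1} is p-positive
iff the coefficient of x^k in P_ν/(1+x) is nonnegative for every ν of size n
(`isPPositive_ribbonTriangle_iff`).

Positivity holds for k = 1 trivially. For k = 3, either ν has a part 1 and 1 + x divides P_ν with a
nonnegative quotient, or P_ν has no terms in x and x². The symmetry k ↔ n+1-k gives n and n-2; for n
= 2m it also gives r_{n,m} = r_{n,m+1}, half of q_m². Every other k is excluded by one partition
into at most four odd parts, since (1 + x^{2t+1})/(1+x) has negative odd coefficients. -/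

open Finset.HasAntidiagonal

/-! ### Tableaux of the triangle as hook words -/

/-- The relation between consecutive letters of a weakly increasing word in which only the
letters with second component `c` may be repeated. -/
def letterRel (c : Bool) (x y : MarkedLetter) : Prop := x < y ∨ (x = y ∧ (ofLex x).2 = c)

theorem letterRel.le {c : Bool} {x y : MarkedLetter} (h : letterRel c x y) : x ≤ y := by
  rcases h with h | h
  · exact h.le
  · exact h.1.le

theorem letterRel.trans {c : Bool} {x y z : MarkedLetter} (h : letterRel c x y)
    (h' : letterRel c y z) : letterRel c x z := by
  rcases h with h | ⟨rfl, h⟩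
  · exact Or.inl (h.trans_le h'.le)
  · exact h'

/-- The order is total, and a repeated letter is either unmarked or marked. This dichotomy is what
splits a product of a row and a column into exactly two hooks. -/
theorem not_letterRel_true {x y : MarkedLetter} :
    ¬ letterRel true x y ↔ letterRel false y x := by
  unfold letterRel
  rcases lt_trichotomy x y with h | rfl | h
  · simp [h, h.not_gt, h.ne']
  · simp
  · simp [h, h.not_gt, h.ne']

/-- The content of a word. -/
noncomputable def wordContent {n : ℕ} (w : Fin n → MarkedLetter) : ℕ →₀ ℕ :=
  ∑ i, Finsupp.single (w i).index 1

/-- The generating function of the words with a given property, by content. -/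
noncomputable def wordSeries {n : ℕ} (P : (Fin n → MarkedLetter) → Prop) : MvPowerSeries ℕ ℚ :=
  fun d => (Nat.card {w : Fin n → MarkedLetter // P w ∧ wordContent w = d} : ℚ)

/-- All pairs of letters are in the relation `letterRel c`. -/
def IsChainWord (c : Bool) {n : ℕ} (w : Fin n → MarkedLetter) : Prop :=
  ∀ i j, i < j → letterRel c (w i) (w j)

/-- Words that rise up to position `r` and do not rise from there on. -/
def IsHookWord {n : ℕ} (r : ℕ) (w : Fin n → MarkedLetter) : Prop :=
  (∀ i j : Fin n, i < j → (j : ℕ) ≤ r → letterRel true (w i) (w j)) ∧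
  (∀ i j : Fin n, i < j → r ≤ (i : ℕ) → letterRel false (w j) (w i))

/-- The boxes of the triangle, read along the row from left to right and then up the column. -/
def triangleBoxEquiv (n k : ℕ) (hk : 1 ≤ k) (h : k ≤ n) :
    Fin n ≃ ((StrictPartition.consecutive n k h).shiftedSkewDiagram
        (StrictPartition.consecutive (n - 1) (k - 1) (Nat.sub_le_sub_right h 1))) where
  toFun i := ⟨if (i : ℕ) ≤ n - k then (k - 1, k - 1 + i) else (n - 1 - i, n - 1), by
    have := i.2
    split_ifs <;> rw [mem_triangle_diagram n k hk h] <;> omega⟩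
  invFun b := ⟨if b.1.1 = k - 1 then b.1.2 - (k - 1) else n - 1 - b.1.1, by
    obtain ⟨⟨x, y⟩, hb⟩ := b
    rw [mem_triangle_diagram n k hk h] at hb
    dsimp only
    split_ifs <;> omega⟩
  left_inv i := by
    have := i.2
    ext
    dsimp only
    split_ifs <;> dsimp only at * <;> omega
  right_inv b := by
    obtain ⟨⟨x, y⟩, hb⟩ := b
    rw [mem_triangle_diagram n k hk h] at hb
    ext <;> dsimp only <;> split_ifs <;> dsimp only at * <;> omega

theorem triangleBoxEquiv_row {n k : ℕ} (hk : 1 ≤ k) (h : k ≤ n) (i j : Fin n) (hij : i < j) :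
    (triangleBoxEquiv n k hk h i).1.1 = (triangleBoxEquiv n k hk h j).1.1 ↔ (j : ℕ) ≤ n - k := by
  have := i.2
  have := j.2
  have : (i : ℕ) < j := hij
  simp only [triangleBoxEquiv, Equiv.coe_fn_mk]
  split_ifs <;> dsimp only <;> omega

/-- The corner has index `n - k` and lies both in the row and in the column, so the bound is weak
here as well as in `triangleBoxEquiv_row`. -/
theorem triangleBoxEquiv_col {n k : ℕ} (hk : 1 ≤ k) (h : k ≤ n) (i j : Fin n) (hij : i < j) :
    (triangleBoxEquiv n k hk h i).1.2 = (triangleBoxEquiv n k hk h j).1.2 ↔ n - k ≤ (i : ℕ) := by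
  have := i.2
  have := j.2
  have : (i : ℕ) < j := hij
  simp only [triangleBoxEquiv, Equiv.coe_fn_mk]
  split_ifs <;> dsimp only <;> omega

theorem triangleBoxEquiv_row_lt {n k : ℕ} (hk : 1 ≤ k) (h : k ≤ n) (i j : Fin n) (hij : i < j)
    (hj : (j : ℕ) ≤ n - k) :
    (triangleBoxEquiv n k hk h i).1.2 < (triangleBoxEquiv n k hk h j).1.2 := by
  have : (i : ℕ) < j := hij
  simp only [triangleBoxEquiv, Equiv.coe_fn_mk]
  split_ifs <;> dsimp only <;> omega

theorem triangleBoxEquiv_col_lt {n k : ℕ} (hk : 1 ≤ k) (h : k ≤ n) (i j : Fin n) (hij : i < j)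
    (hi : n - k ≤ (i : ℕ)) :
    (triangleBoxEquiv n k hk h j).1.1 < (triangleBoxEquiv n k hk h i).1.1 := by
  have := j.2
  have : (i : ℕ) < j := hij
  simp only [triangleBoxEquiv, Equiv.coe_fn_mk]
  split_ifs <;> dsimp only <;> omega

theorem MarkedShiftedTableau.entry_injective {D : Finset (ℕ × ℕ)} :
    Function.Injective (MarkedShiftedTableau.entry (D := D)) := by
  rintro ⟨e, _, _, _, _⟩ ⟨e', _, _, _, _⟩ h
  dsimp only at h
  subst h
  rfl

theorem MarkedShiftedTableau.isHookWord {n k : ℕ} (hk : 1 ≤ k) (h : k ≤ n)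
    (T : MarkedShiftedTableau ((StrictPartition.consecutive n k h).shiftedSkewDiagram
        (StrictPartition.consecutive (n - 1) (k - 1) (Nat.sub_le_sub_right h 1)))) :
    IsHookWord (n - k) (T.entry ∘ triangleBoxEquiv n k hk h) := by
  constructor
  · intro i j hij hj
    have hrow := (triangleBoxEquiv_row hk h i j hij).2 hj
    have hlt := triangleBoxEquiv_row_lt hk h i j hij hj
    rcases (T.row_weak _ _ hrow hlt.le).lt_or_eq with hl | he
    · exact Or.inl hl
    · refine Or.inr ⟨he, ?_⟩
      by_contra hm
      have := T.row_marked _ _ hrow he (by simpa [MarkedLetter.IsMarked] using hm)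
      rw [this] at hlt
      exact lt_irrefl _ hlt
  · intro i j hij hi
    have hcol := ((triangleBoxEquiv_col hk h i j hij).2 hi).symm
    have hlt := triangleBoxEquiv_col_lt hk h i j hij hi
    rcases (T.col_weak _ _ hcol hlt.le).lt_or_eq with hl | he
    · exact Or.inl hl
    · refine Or.inr ⟨he, ?_⟩
      by_contra hm
      have := T.col_unmarked _ _ hcol he (by simpa [MarkedLetter.IsMarked] using hm)
      rw [this] at hlt
      exact lt_irrefl _ hlt

/-- The marked shifted tableau with a given reading word. -/
def tableauOfHookWord {n k : ℕ} (hk : 1 ≤ k) (h : k ≤ n) (w : Fin n → MarkedLetter)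
    (hw : IsHookWord (n - k) w) :
    MarkedShiftedTableau ((StrictPartition.consecutive n k h).shiftedSkewDiagram
        (StrictPartition.consecutive (n - 1) (k - 1) (Nat.sub_le_sub_right h 1))) where
  entry b := w ((triangleBoxEquiv n k hk h).symm b)
  row_weak b c hr hc := by
    obtain ⟨i, rfl⟩ := (triangleBoxEquiv n k hk h).surjective b
    obtain ⟨j, rfl⟩ := (triangleBoxEquiv n k hk h).surjective c
    simp only [Equiv.symm_apply_apply]
    rcases lt_trichotomy i j with hij | rfl | hij
    · exact (hw.1 i j hij ((triangleBoxEquiv_row hk h i j hij).1 hr)).le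
    · exact le_rfl
    · exact absurd (triangleBoxEquiv_row_lt hk h j i hij
        ((triangleBoxEquiv_row hk h j i hij).1 hr.symm)) hc.not_gt
  col_weak b c hr hc := by
    obtain ⟨i, rfl⟩ := (triangleBoxEquiv n k hk h).surjective b
    obtain ⟨j, rfl⟩ := (triangleBoxEquiv n k hk h).surjective c
    simp only [Equiv.symm_apply_apply]
    rcases lt_trichotomy i j with hij | rfl | hij
    · exact absurd (triangleBoxEquiv_col_lt hk h i j hij
        ((triangleBoxEquiv_col hk h i j hij).1 hr)) hc.not_gt
    · exact le_rfl
    · exact (hw.2 j i hij ((triangleBoxEquiv_col hk h j i hij).1 hr.symm)).le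
  col_unmarked b c hr he hm := by
    obtain ⟨i, rfl⟩ := (triangleBoxEquiv n k hk h).surjective b
    obtain ⟨j, rfl⟩ := (triangleBoxEquiv n k hk h).surjective c
    simp only [Equiv.symm_apply_apply] at he hm
    rcases lt_trichotomy i j with hij | rfl | hij
    · rcases hw.2 i j hij ((triangleBoxEquiv_col hk h i j hij).1 hr) with h1 | h1
      · exact absurd he.symm h1.ne
      · exact absurd (he ▸ h1.2) hm
    · rfl
    · rcases hw.2 j i hij ((triangleBoxEquiv_col hk h j i hij).1 hr.symm) with h1 | h1
      · exact absurd he h1.ne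
      · exact absurd h1.2 hm
  row_marked b c hr he hm := by
    obtain ⟨i, rfl⟩ := (triangleBoxEquiv n k hk h).surjective b
    obtain ⟨j, rfl⟩ := (triangleBoxEquiv n k hk h).surjective c
    simp only [Equiv.symm_apply_apply] at he hm
    simp only [MarkedLetter.IsMarked] at hm
    rcases lt_trichotomy i j with hij | rfl | hij
    · rcases hw.1 i j hij ((triangleBoxEquiv_row hk h i j hij).1 hr) with h1 | h1
      · exact absurd he h1.ne
      · simp [hm] at h1
    · rfl
    · rcases hw.1 j i hij ((triangleBoxEquiv_row hk h j i hij).1 hr.symm) with h1 | h1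
      · exact absurd he.symm h1.ne
      · simp [← he, hm] at h1

theorem MarkedShiftedTableau.content_eq_wordContent {D : Finset (ℕ × ℕ)} {n : ℕ} (φ : Fin n ≃ D)
    (T : MarkedShiftedTableau D) : T.content = wordContent (T.entry ∘ φ) := by
  unfold MarkedShiftedTableau.content wordContent
  exact (Equiv.sum_comp φ (fun b => Finsupp.single (T.entry b).index 1)).symm

theorem ribbonTriangle_eq_wordSeries (n k : ℕ) (hk : 1 ≤ k) (h : k ≤ n) :
    ribbonTriangle n k h = wordSeries (n := n) (IsHookWord (n - k)) := by
  funext d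
  refine congrArg Nat.cast (Nat.card_congr (Equiv.ofBijective
    (fun T => ⟨T.1.entry ∘ triangleBoxEquiv n k hk h, T.1.isHookWord hk h, ?_⟩) ⟨?_, ?_⟩))
  · rw [← MarkedShiftedTableau.content_eq_wordContent]
    exact T.2
  · intro T T' hT
    apply Subtype.ext
    apply MarkedShiftedTableau.entry_injective
    exact (triangleBoxEquiv n k hk h).surjective.injective_comp_right (congrArg Subtype.val hT)
  · rintro ⟨w, hw, hd⟩
    have hcomp : (tableauOfHookWord hk h w hw).entry ∘ triangleBoxEquiv n k hk h = w := by
      funext i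
      simp [tableauOfHookWord]
    refine ⟨⟨tableauOfHookWord hk h w hw, ?_⟩, Subtype.ext hcomp⟩
    rw [MarkedShiftedTableau.content_eq_wordContent (triangleBoxEquiv n k hk h), hcomp, hd]

/-! ### Sums and products of generating functions of words -/

theorem finite_wordContent_eq {n : ℕ} (P : (Fin n → MarkedLetter) → Prop) (d : ℕ →₀ ℕ) :
    Finite {w : Fin n → MarkedLetter // P w ∧ wordContent w = d} := by
  have key : ∀ (T : {w : Fin n → MarkedLetter // P w ∧ wordContent w = d}) (b : Fin n),
      (T.1 b).index ∈ d.support := by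
    rintro ⟨w, _, rfl⟩ b
    have h1 : (Finsupp.single (w b).index 1 : ℕ →₀ ℕ) ≤ wordContent w :=
      Finset.single_le_sum (f := fun b => (Finsupp.single (w b).index 1 : ℕ →₀ ℕ))
        (fun _ _ => bot_le) (Finset.mem_univ b)
    have h2 := h1 (w b).index
    rw [Finsupp.single_eq_same] at h2
    rw [Finsupp.mem_support_iff]
    show wordContent w (w b).index ≠ 0
    omega
  let F : {w : Fin n → MarkedLetter // P w ∧ wordContent w = d} → (Fin n → d.support × Bool) :=
    fun T b => (⟨(T.1 b).index, key T b⟩, (ofLex (T.1 b)).2)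
  refine Finite.of_injective F fun T T' hF => Subtype.ext (funext fun b => ?_)
  have hb := congrFun hF b
  simp only [F, Prod.mk.injEq, Subtype.mk.injEq] at hb
  exact ofLex.injective (Prod.ext hb.1 hb.2)

theorem wordSeries_congr {n : ℕ} {P Q : (Fin n → MarkedLetter) → Prop} (h : ∀ w, P w ↔ Q w) :
    wordSeries P = wordSeries Q := by
  rw [funext fun w => propext (h w)]

theorem wordSeries_or {n : ℕ} {P Q : (Fin n → MarkedLetter) → Prop} (h : ∀ w, P w → ¬ Q w) :
    wordSeries (fun w => P w ∨ Q w) = wordSeries P + wordSeries Q := by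
  funext d
  have := finite_wordContent_eq P d
  have := finite_wordContent_eq Q d
  show (Nat.card _ : ℚ) = (Nat.card _ : ℚ) + (Nat.card _ : ℚ)
  rw [← Nat.cast_add, ← Nat.card_sum]
  classical
  refine congrArg Nat.cast (Nat.card_congr ?_)
  refine (Equiv.subtypeEquivRight fun w => or_and_right).trans
    (subtypeOrEquiv _ _ ?_)
  rw [Pi.disjoint_iff]
  intro w
  simp only [Prop.disjoint_iff]
  have := h w
  tauto

theorem wordContent_append {a b : ℕ} (u : Fin a → MarkedLetter) (v : Fin b → MarkedLetter) :
    wordContent (Fin.append u v) = wordContent u + wordContent v := by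
  simp [wordContent, Fin.sum_univ_add]

theorem wordSeries_mul {a b : ℕ} (P : (Fin a → MarkedLetter) → Prop)
    (Q : (Fin b → MarkedLetter) → Prop) :
    wordSeries P * wordSeries Q =
      wordSeries fun w : Fin (a + b) → MarkedLetter =>
        P (fun i => w (Fin.castAdd b i)) ∧ Q (fun i => w (Fin.natAdd a i)) := by
  classical
  ext d
  rw [MvPowerSeries.coeff_mul]
  have := fun d => finite_wordContent_eq P d
  have := fun d => finite_wordContent_eq Q d
  show ∑ p ∈ _, (Nat.card _ : ℚ) * (Nat.card _ : ℚ) = (Nat.card _ : ℚ)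
  simp only [← Nat.cast_mul, ← Nat.card_prod]
  rw [← Finset.sum_coe_sort, ← Nat.cast_sum, ← Nat.card_sigma]
  refine congrArg Nat.cast (Nat.card_congr (Equiv.ofBijective
    (fun x => ⟨Fin.append x.2.1.1 x.2.2.1, ?_, ?_⟩) ⟨?_, ?_⟩))
  · simpa using ⟨x.2.1.2.1, x.2.2.2.1⟩
  · rw [wordContent_append, x.2.1.2.2, x.2.2.2.2]
    exact mem_antidiagonal.1 x.1.2
  · rintro ⟨⟨⟨d1, d2⟩, hd⟩, ⟨u, hu, (rfl : _ = d1)⟩, ⟨v, hv, (rfl : _ = d2)⟩⟩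
      ⟨⟨⟨e1, e2⟩, he⟩, ⟨u', hu1, (rfl : _ = e1)⟩, ⟨v', hv1, (rfl : _ = e2)⟩⟩ hxy
    replace hxy : Fin.append u v = Fin.append u' v' := congrArg Subtype.val hxy
    obtain ⟨rfl, rfl⟩ : u = u' ∧ v = v' := by
      constructor
      · funext i
        simpa using congrFun hxy (Fin.castAdd b i)
      · funext i
        simpa using congrFun hxy (Fin.natAdd a i)
    rfl
  · rintro ⟨w, ⟨hP, hQ⟩, hd⟩
    have hw : Fin.append (fun i => w (Fin.castAdd b i)) (fun i => w (Fin.natAdd a i)) = w :=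
      Fin.append_castAdd_natAdd
    refine ⟨⟨⟨(wordContent fun i => w (Fin.castAdd b i), wordContent fun i => w (Fin.natAdd a i)),
      ?_⟩, ⟨_, hP, rfl⟩, ⟨_, hQ, rfl⟩⟩, Subtype.ext hw⟩
    rw [mem_antidiagonal, ← wordContent_append, hw, hd]

/-- Only positions `a` and `a + 1` are left uncompared by the two factors. If the word rises there,
the first column letter becomes the corner; otherwise the last row letter does. Transitivity of
`letterRel` extends the comparison to all other pairs. -/
theorem isHookWord_or_iff {a b : ℕ} (w : Fin ((a + 1) + (b + 1)) → MarkedLetter) :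
    (IsChainWord true (fun i => w (Fin.castAdd (b + 1) i)) ∧
      ∀ i j : Fin (b + 1), i < j →
        letterRel false (w (Fin.natAdd (a + 1) j)) (w (Fin.natAdd (a + 1) i))) ↔
    IsHookWord (a + 1) w ∨ IsHookWord a w := by
  have ha : a < a + 1 + (b + 1) := by omega
  have ha' : a + 1 < a + 1 + (b + 1) := by omega
  constructor
  · rintro ⟨h1, h2⟩
    have h1' : ∀ i j : Fin (a + 1 + (b + 1)), i < j → (j : ℕ) ≤ a →
        letterRel true (w i) (w j) := by
      intro i j hij hj
      have hij' : (i : ℕ) < j := hij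
      exact h1 ⟨i, by omega⟩ ⟨j, by omega⟩ hij'
    have h2' : ∀ i j : Fin (a + 1 + (b + 1)), i < j → a + 1 ≤ (i : ℕ) →
        letterRel false (w j) (w i) := by
      intro i j hij hi
      have hij' : (i : ℕ) < j := hij
      have := h2 ⟨i - (a + 1), by omega⟩ ⟨j - (a + 1), by omega⟩
        (by rw [Fin.mk_lt_mk]; omega)
      convert this using 2 <;> ext <;> simp <;> omega
    by_cases hs : letterRel true (w ⟨a, ha⟩) (w ⟨a + 1, ha'⟩)
    · refine Or.inl ⟨fun i j hij hj => ?_, h2'⟩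
      rcases hj.lt_or_eq with hj | hj
      · exact h1' i j hij (by omega)
      · have hij' : (i : ℕ) < j := hij
        obtain rfl : j = ⟨a + 1, ha'⟩ := Fin.ext hj
        rcases (show (i : ℕ) ≤ a by omega).lt_or_eq with hi | hi
        · exact (h1' i ⟨a, ha⟩ hi le_rfl).trans hs
        · obtain rfl : i = ⟨a, ha⟩ := Fin.ext hi
          exact hs
    · rw [not_letterRel_true] at hs
      refine Or.inr ⟨h1', fun i j hij hi => ?_⟩
      have hij' : (i : ℕ) < j := hij
      rcases hi.lt_or_eq with hi | hi
      · exact h2' i j hij hi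
      · obtain rfl : i = ⟨a, ha⟩ := Fin.ext hi.symm
        dsimp only at hij'
        rcases (show a + 1 ≤ (j : ℕ) by omega).lt_or_eq with hj | hj
        · exact (h2' ⟨a + 1, ha'⟩ j hj le_rfl).trans hs
        · obtain rfl : j = ⟨a + 1, ha'⟩ := Fin.ext hj.symm
          exact hs
  · rintro h
    constructor
    · intro i j hij
      have hij' : (i : ℕ) < j := hij
      have := j.2
      rcases h with h | h
      · exact h.1 _ _ hij' (by rw [Fin.val_castAdd]; omega)
      · exact h.1 _ _ hij' (by rw [Fin.val_castAdd]; omega)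
    · intro i j hij
      have hij' : (i : ℕ) < j := hij
      rcases h with h | h
      · exact h.2 _ _ (by rw [Fin.lt_def]; simpa using hij') (by simp)
      · exact h.2 _ _ (by rw [Fin.lt_def]; simpa using hij') (by rw [Fin.val_natAdd]; omega)

theorem not_isHookWord_of_succ {a n : ℕ} (ha : a + 1 < n) (w : Fin n → MarkedLetter)
    (h : IsHookWord (a + 1) w) : ¬ IsHookWord a w := fun h' =>
  not_letterRel_true.2 (h'.2 ⟨a, by omega⟩ ⟨a + 1, ha⟩ (by simp) le_rfl)
    (h.1 _ _ (by simp) le_rfl)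

/-! ### Rows, columns and the product rule -/

/-- The Schur `Q`-function of a row or a column, as a generating function of words. -/
noncomputable def chainSeries (c : Bool) (n : ℕ) : MvPowerSeries ℕ ℚ :=
  wordSeries (n := n) (IsChainWord c)

/-- Columns are read upwards, so reversing the word turns them into chains. -/
theorem wordSeries_antitone (n : ℕ) :
    (wordSeries fun w : Fin n → MarkedLetter => ∀ i j, i < j → letterRel false (w j) (w i)) =
      chainSeries false n := by
  funext d
  refine congrArg Nat.cast (Nat.card_congr
    ((Fin.revPerm.arrowCongr (Equiv.refl MarkedLetter)).subtypeEquiv fun w => ?_))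
  refine and_congr ⟨fun h i j hij => ?_, fun h i j hij => ?_⟩ (Eq.congr_left ?_)
  · exact h _ _ (Fin.rev_lt_rev.2 hij)
  · simpa using h _ _ (Fin.rev_lt_rev.2 hij)
  · exact (Equiv.sum_comp Fin.revPerm (fun i => Finsupp.single (w i).index 1)).symm

theorem ribbonTriangle_one (n : ℕ) (h : 1 ≤ n) : ribbonTriangle n 1 h = chainSeries true n := by
  rw [ribbonTriangle_eq_wordSeries n 1 le_rfl h]
  refine wordSeries_congr fun w => ⟨fun h i j hij => h.1 i j hij ?_,
    fun h => ⟨fun i j hij _ => h i j hij, fun i j hij hi => ?_⟩⟩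
  · have := j.2
    omega
  · have := j.2
    have : (i : ℕ) < j := hij
    omega

theorem ribbonTriangle_self (n : ℕ) (h : 1 ≤ n) :
    ribbonTriangle n n le_rfl = chainSeries false n := by
  rw [ribbonTriangle_eq_wordSeries n n h le_rfl, ← wordSeries_antitone]
  refine wordSeries_congr fun w => ⟨fun h i j hij => h.2 i j hij (by omega),
    fun h => ⟨fun i j hij hj => ?_, fun i j hij _ => h i j hij⟩⟩
  have : (i : ℕ) < j := hij
  omega

theorem chainSeries_mul (a b : ℕ) :
    chainSeries true (a + 1) * chainSeries false (b + 1) =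
      ribbonTriangle ((a + 1) + (b + 1)) (b + 1) (by omega) +
      ribbonTriangle ((a + 1) + (b + 1)) (b + 2) (by omega) := by
  rw [ribbonTriangle_eq_wordSeries _ _ (by omega), ribbonTriangle_eq_wordSeries _ _ (by omega),
    ← wordSeries_antitone, chainSeries, wordSeries_mul, wordSeries_congr isHookWord_or_iff,
    wordSeries_or, show a + 1 + (b + 1) - (b + 1) = a + 1 by omega,
    show a + 1 + (b + 1) - (b + 2) = a by omega]
  exact fun w => not_isHookWord_of_succ (by omega) w

/-! ### Counting row and column words of given content -/

/-- The multiset of letters of a word. -/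
def wordMultiset {n : ℕ} (w : Fin n → MarkedLetter) : Multiset MarkedLetter :=
  (List.ofFn w : Multiset MarkedLetter)

theorem wordContent_apply {n : ℕ} (w : Fin n → MarkedLetter) (i : ℕ) (c : Bool) :
    wordContent w i = (wordMultiset w).count (toLex (i, c)) +
      (wordMultiset w).count (toLex (i, !c)) := by
  have h : wordMultiset w = ∑ j, {w j} := by
    rw [wordMultiset]
    clear i c
    induction n with
    | zero => simp
    | succ n ih =>
      rw [List.ofFn_succ, ← Multiset.cons_coe, ih fun j => w j.succ, Fin.sum_univ_succ,
        Multiset.singleton_add]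
  rw [h, wordContent, Finset.sum_apply', Multiset.count_sum', Multiset.count_sum',
    ← Finset.sum_add_distrib]
  refine Finset.sum_congr rfl fun j _ => ?_
  obtain ⟨⟨x, e⟩, hx⟩ : ∃ x, w j = toLex x := ⟨_, (toLex_ofLex _).symm⟩
  rw [hx]
  simp only [Multiset.count_singleton, Finsupp.single_apply, MarkedLetter.index, ofLex_toLex,
    EmbeddingLike.apply_eq_iff_eq, Prod.mk.injEq]
  by_cases h : x = i
  · cases c <;> cases e <;> simp [h]
  · cases c <;> cases e <;> simp [h, Ne.symm h]

/-- A chain word is thus the sorted list of a multiset in which the letters of the other marking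
occur at most once, which reduces counting words to counting multisets. -/
theorem pairwise_letterRel_iff (c : Bool) (l : List MarkedLetter) :
    l.Pairwise (letterRel c) ↔
      l.Pairwise (· ≤ ·) ∧ ∀ i, (l : Multiset MarkedLetter).count (toLex (i, !c)) ≤ 1 := by
  induction l with
  | nil => simp
  | cons x l ih =>
    rw [List.pairwise_cons, List.pairwise_cons, ih, ← Multiset.cons_coe]
    constructor
    · rintro ⟨h1, h2, h3⟩
      refine ⟨⟨fun y hy => (h1 y hy).le, h2⟩, fun i => ?_⟩
      rw [Multiset.count_cons]
      split_ifs with hx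
      · rw [Multiset.count_eq_zero.2]
        intro hm
        rcases h1 _ (Multiset.mem_coe.1 hm) with h | h
        · exact h.ne hx.symm
        · rw [← hx] at h
          simp at h
      · exact h3 i
    · rintro ⟨⟨h1, h2⟩, h3⟩
      refine ⟨fun y hy => ?_, h2, fun i => (Multiset.count_le_count_cons _ _ _).trans (h3 i)⟩
      rcases (h1 y hy).lt_or_eq with h | rfl
      · exact Or.inl h
      · refine Or.inr ⟨rfl, ?_⟩
        by_contra hc
        have hx : x = toLex ((ofLex x).1, !c) := by
          apply ofLex.injective
          ext
          · rfl
          · simpa [Bool.eq_not] using hc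
        have := h3 (ofLex x).1
        rw [← hx, Multiset.count_cons_self] at this
        have := Multiset.count_pos.2 (Multiset.mem_coe.2 hy)
        omega

theorem isChainWord_iff (c : Bool) {n : ℕ} (w : Fin n → MarkedLetter) :
    IsChainWord c w ↔ (List.ofFn w).Pairwise (· ≤ ·) ∧
      ∀ i, (wordMultiset w).count (toLex (i, !c)) ≤ 1 := by
  rw [wordMultiset, ← pairwise_letterRel_iff, List.pairwise_ofFn]
  rfl

theorem degree_wordContent {n : ℕ} (w : Fin n → MarkedLetter) : (wordContent w).degree = n := by
  simp [wordContent, map_sum]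

theorem exists_isChainWord (c : Bool) (d : ℕ →₀ ℕ) (S : Finset ℕ) (hS : S ⊆ d.support) :
    ∃ w : Fin d.degree → MarkedLetter, (IsChainWord c w ∧ wordContent w = d) ∧
      ∀ i, toLex (i, !c) ∈ wordMultiset w ↔ i ∈ S := by
  classical
  -- For `i ∈ S`, one of the `d i` letters has marking `!c`, the rest have marking `c`. The
  -- truncated subtraction is exact because `S` lies in the support of `d`.
  obtain ⟨M, hM⟩ : ∃ M : Multiset MarkedLetter, ∀ i,
      M.count (toLex (i, c)) = d i - (if i ∈ S then 1 else 0) ∧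
      M.count (toLex (i, !c)) = if i ∈ S then 1 else 0 := by
    refine ⟨∑ j ∈ d.support, (Multiset.replicate (d j - if j ∈ S then 1 else 0) (toLex (j, c)) +
      Multiset.replicate (if j ∈ S then 1 else 0) (toLex (j, !c))), fun i => ?_⟩
    simp only [Multiset.count_sum', Multiset.count_add, Multiset.count_replicate,
      EmbeddingLike.apply_eq_iff_eq, Prod.mk.injEq]
    constructor
    · rw [Finset.sum_eq_single i]
      · simp
      · intro j _ hj
        simp [hj]
      · intro hi
        simp at hi
        simp [hi]
    · rw [Finset.sum_eq_single i]
      · simp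
      · intro j _ hj
        simp [hj]
      · intro hi
        have : i ∉ S := fun h => hi (hS h)
        simp [this]
  have hword : ∀ (n : ℕ) (w : Fin n → MarkedLetter), List.ofFn w = M.sort (· ≤ ·) →
      (IsChainWord c w ∧ wordContent w = d) ∧ ∀ i, toLex (i, !c) ∈ wordMultiset w ↔ i ∈ S := by
    intro n w hw
    have hwM : wordMultiset w = M := by
      rw [wordMultiset, hw, Multiset.sort_eq]
    refine ⟨⟨?_, ?_⟩, fun i => ?_⟩
    · rw [isChainWord_iff, hw, hwM]
      refine ⟨Multiset.pairwise_sort _ _, fun i => ?_⟩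
      rw [(hM i).2]
      split_ifs <;> simp
    · ext i
      rw [wordContent_apply w i c, hwM, (hM i).1, (hM i).2]
      split_ifs with h
      · have := hS h
        rw [Finsupp.mem_support_iff] at this
        omega
      · rfl
    · rw [hwM, ← Multiset.count_pos, (hM i).2]
      split_ifs with h <;> simp [h]
  have h1 := hword _ (M.sort (· ≤ ·)).get (List.ofFn_get _)
  have hdeg := degree_wordContent (M.sort (· ≤ ·)).get
  rw [h1.1.2] at hdeg
  rw [hdeg]
  exact ⟨_, h1⟩

/-- For each variable that occurs, the only freedom is whether its non-repeatable letter is used.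
The count does not depend on `c`, so rows and columns have the same generating function. -/
theorem card_isChainWord (c : Bool) (n : ℕ) (d : ℕ →₀ ℕ) :
    Nat.card {w : Fin n → MarkedLetter // IsChainWord c w ∧ wordContent w = d} =
      if d.degree = n then 2 ^ d.support.card else 0 := by
  classical
  split_ifs with hd
  · subst hd
    rw [← Finset.card_powerset, ← Nat.card_eq_finsetCard]
    refine Nat.card_congr (Equiv.ofBijective (fun w =>
      ⟨d.support.filter fun i => toLex (i, !c) ∈ wordMultiset w.1, ?_⟩) ⟨?_, ?_⟩)
    · rw [Finset.mem_powerset]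
      exact Finset.filter_subset _ _
    · rintro ⟨w, hw, hd⟩ ⟨w', hw', hd'⟩ h
      have h := congrArg Subtype.val h
      dsimp only at h
      have hmem : ∀ (w : Fin d.degree → MarkedLetter), wordContent w = d → ∀ i,
          i ∈ d.support.filter (fun i => toLex (i, !c) ∈ wordMultiset w) ↔
            toLex (i, !c) ∈ wordMultiset w := by
        intro w hd i
        have := wordContent_apply w i c
        rw [hd] at this
        rw [Finset.mem_filter, and_iff_right_iff_imp, Finsupp.mem_support_iff,
          ← Multiset.count_pos]
        omega
      rw [isChainWord_iff] at hw hw'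
      have hM : wordMultiset w = wordMultiset w' := by
        have key : ∀ i, (wordMultiset w).count (toLex (i, !c)) =
            (wordMultiset w').count (toLex (i, !c)) := by
          intro i
          have h1 := hmem w hd i
          rw [h, hmem w' hd' i, ← Multiset.count_pos, ← Multiset.count_pos] at h1
          have := hw.2 i
          have := hw'.2 i
          omega
        ext x
        obtain ⟨⟨i, e⟩, rfl⟩ : ∃ y, x = toLex y := ⟨_, (toLex_ofLex _).symm⟩
        by_cases he : e = c
        · subst he
          have h1 := wordContent_apply w i e
          have h2 := wordContent_apply w' i e
          rw [hd] at h1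
          rw [hd'] at h2
          have := key i
          omega
        · obtain rfl : e = !c := by
            cases e <;> cases c <;> simp_all
          exact key i
      apply Subtype.ext
      apply List.ofFn_injective
      exact (Multiset.coe_eq_coe.1 hM).eq_of_pairwise' hw.1 hw'.1
    · rintro ⟨S, hS⟩
      rw [Finset.mem_powerset] at hS
      obtain ⟨w, hw, hwS⟩ := exists_isChainWord c d S hS
      refine ⟨⟨w, hw⟩, Subtype.ext ?_⟩
      ext i
      simp only [Finset.mem_filter, hwS]
      exact ⟨fun h => h.2, fun h => ⟨hS h, h⟩⟩
  · rw [Nat.card_eq_zero]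
    refine Or.inl ⟨fun w => hd ?_⟩
    rw [← w.2.2, degree_wordContent]

theorem coeff_chainSeries (c : Bool) (n : ℕ) (d : ℕ →₀ ℕ) :
    MvPowerSeries.coeff d (chainSeries c n) = if d.degree = n then 2 ^ d.support.card else 0 := by
  show (Nat.card _ : ℚ) = _
  rw [card_isChainWord]
  push_cast
  rfl

/-! ### Newton's recurrence for the one-row functions -/

theorem coeff_powerSum (r : ℕ) (d : ℕ →₀ ℕ) [Decidable (∃ i, d = Finsupp.single i r)] :
    MvPowerSeries.coeff d (powerSum r) = if ∃ i, d = Finsupp.single i r then 1 else 0 := by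
  show powerSum r d = _
  unfold powerSum
  congr

/-- For `r > 0` the monomials of `p_r` are indexed injectively by the variable, so the convolution
is a sum over the variable whose `r`-th power is split off. -/
theorem coeff_powerSum_mul {r : ℕ} (hr : 0 < r) (g : MvPowerSeries ℕ ℚ) (d : ℕ →₀ ℕ) :
    MvPowerSeries.coeff d (powerSum r * g) =
      ∑ i ∈ d.support, if r ≤ d i then MvPowerSeries.coeff (d - Finsupp.single i r) g else 0 := by
  classical
  rw [MvPowerSeries.coeff_mul, ← Finset.sum_filter]
  symm
  refine Finset.sum_of_injOn (fun i => (Finsupp.single i r, d - Finsupp.single i r)) ?_ ?_ ?_ ?_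
  · intro i _ j _ hij
    exact Finsupp.single_left_injective hr.ne' (congrArg Prod.fst hij)
  · intro i hi
    rw [Finset.mem_coe, Finset.mem_filter] at hi
    rw [Finset.mem_coe, mem_antidiagonal]
    exact add_tsub_cancel_of_le (Finsupp.single_le_iff.2 hi.2)
  · rintro ⟨a, b⟩ hab hn
    rw [mem_antidiagonal] at hab
    rw [coeff_powerSum, if_neg, zero_mul]
    rintro ⟨i, hi⟩
    dsimp only at hi hab
    subst hi hab
    refine hn ⟨i, ?_, ?_⟩
    · rw [Finset.mem_coe, Finset.mem_filter, Finsupp.mem_support_iff, Finsupp.add_apply,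
        Finsupp.single_eq_same]
      omega
    · simp
  · intro i _
    rw [coeff_powerSum, if_pos ⟨i, rfl⟩, one_mul]

theorem chainSeries_zero (c : Bool) : chainSeries c 0 = 1 := by
  classical
  ext d
  rw [coeff_chainSeries, MvPowerSeries.coeff_one]
  by_cases h : d = 0
  · simp [h]
  · rw [if_neg, if_neg h]
    rwa [Finsupp.degree_eq_zero_iff]

/-- The coefficient of `p_{i + 1}` in the logarithmic derivative of the generating function of the
one-row Schur `Q`-functions. -/
def oddWeight (i : ℕ) : ℚ := if Even i then 2 else 0

theorem sum_oddWeight (k : ℕ) : ∑ a ∈ Finset.range k, oddWeight a = if Even k then k else k + 1 := by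
  induction k with
  | zero => simp
  | succ k ih =>
    rw [Finset.sum_range_succ, ih, oddWeight]
    by_cases h : Even k
    · have : ¬ Even (k + 1) := by simpa [Nat.even_add_one] using h
      simp [h, this]
      ring
    · have : Even (k + 1) := by simpa [Nat.even_add_one] using h
      simp [h, this]

/-- The contribution of one variable of exponent `m` to the recurrence: splitting off its full power
shrinks the support by one and halves the count 2^c. -/
theorem sum_oddWeight_mul (m c : ℕ) (hm : 0 < m) (hc : 0 < c) :
    ∑ a ∈ Finset.range m, oddWeight a * 2 ^ (if a + 1 = m then c - 1 else c) = m * 2 ^ c := by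
  obtain ⟨k, rfl⟩ : ∃ k, m = k + 1 := ⟨m - 1, by omega⟩
  obtain ⟨c, rfl⟩ : ∃ b, c = b + 1 := ⟨c - 1, by omega⟩
  rw [Finset.sum_range_succ, if_pos rfl]
  have : ∀ a ∈ Finset.range k, oddWeight a * 2 ^ (if a + 1 = k + 1 then c + 1 - 1 else c + 1) =
      oddWeight a * 2 ^ (c + 1) := by
    intro a ha
    rw [Finset.mem_range] at ha
    rw [if_neg (by omega)]
  rw [Finset.sum_congr rfl this, ← Finset.sum_mul, sum_oddWeight, oddWeight, Nat.add_sub_cancel]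
  push_cast
  split_ifs <;> ring

theorem card_support_sub_single (d : ℕ →₀ ℕ) (i r : ℕ) (hr : 0 < r) (hri : r ≤ d i) :
    (d - Finsupp.single i r).support.card =
      if r = d i then d.support.card - 1 else d.support.card := by
  classical
  have hi : i ∈ d.support := by
    rw [Finsupp.mem_support_iff]
    omega
  split_ifs with h
  · rw [← Finset.card_erase_of_mem hi]
    congr 1
    ext j
    by_cases hj : j = i
    · subst hj
      simp [h]
    · simp [hj]
  · congr 1
    ext j
    by_cases hj : j = i
    · subst hj
      simp
      omega
    · simp [Ne.symm hj]

theorem degree_sub_single (d : ℕ →₀ ℕ) (i r : ℕ) (hri : r ≤ d i) :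
    (d - Finsupp.single i r).degree + r = d.degree := by
  conv_rhs => rw [← tsub_add_cancel_of_le (Finsupp.single_le_iff.2 hri)]
  rw [map_add, Finsupp.degree_single]

/-- In each monomial of degree `n + 1`, the variable `i` contributes `d i * 2 ^ d.support.card` to
the right side, and the exponents add up to `n + 1`. -/
theorem chainSeries_newton (c : Bool) (n : ℕ) :
    chainSeries c (n + 1) * (n + 1) =
      ∑ p ∈ antidiagonal n, (oddWeight p.1 • powerSum (p.1 + 1)) * chainSeries c p.2 := by
  ext d
  have h1 : MvPowerSeries.coeff d (chainSeries c (n + 1) * ((n : MvPowerSeries ℕ ℚ) + 1)) =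
      MvPowerSeries.coeff d (chainSeries c (n + 1)) * (n + 1) := by
    have : chainSeries c (n + 1) * ((n : MvPowerSeries ℕ ℚ) + 1) =
        ((n : ℚ) + 1) • chainSeries c (n + 1) := by
      rw [MvPowerSeries.smul_eq_C_mul, mul_comm]
      simp
    rw [this, MvPowerSeries.coeff_smul, mul_comm]
  rw [h1, map_sum, coeff_chainSeries]
  simp only [smul_mul_assoc, MvPowerSeries.coeff_smul, coeff_powerSum_mul (Nat.add_one_pos _),
    Finset.mul_sum]
  rw [Finset.sum_comm]
  simp only [mul_ite, mul_zero, coeff_chainSeries]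
  split_ifs with hd
  · have : ∀ i ∈ d.support, ∑ p ∈ antidiagonal n, (if p.1 + 1 ≤ d i then
        if (d - Finsupp.single i (p.1 + 1)).degree = p.2 then
          oddWeight p.1 * 2 ^ (d - Finsupp.single i (p.1 + 1)).support.card else 0 else 0) =
        d i * 2 ^ d.support.card := by
      intro i hi
      have hdi : d i ≤ n + 1 := hd ▸ Finsupp.le_degree i d
      rw [← sum_oddWeight_mul (d i) _ (Nat.pos_of_ne_zero (Finsupp.mem_support_iff.1 hi))
        (Finset.card_pos.2 ⟨i, hi⟩), Finset.Nat.sum_antidiagonal_eq_sum_range_succ_mk,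
        ← Finset.sum_filter]
      refine Finset.sum_congr ?_ fun a ha => ?_
      · ext a
        simp only [Finset.mem_filter, Finset.mem_range]
        omega
      · rw [Finset.mem_range] at ha
        rw [if_pos, card_support_sub_single d i _ (Nat.succ_pos a) ha]
        have := degree_sub_single d i (a + 1) ha
        dsimp only
        omega
    rw [Finset.sum_congr rfl this, ← Finset.sum_mul, mul_comm]
    congr 1
    have := congrArg (Nat.cast : ℕ → ℚ) hd
    rw [Finsupp.degree_apply] at this
    push_cast at this
    exact this.symm
  · rw [zero_mul]
    symm
    refine Finset.sum_eq_zero fun i _ => Finset.sum_eq_zero fun p hp => ?_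
    rw [mem_antidiagonal] at hp
    split_ifs with h2 h3
    · have := degree_sub_single d i (p.1 + 1) h2
      omega
    · rfl
    · rfl

/-! ### Newton sequences as exponentials -/

/-- The algebra homomorphism sending the variable `X i` to the power sum `p_{i + 1}`. -/
noncomputable def powerSumHom : MvPolynomial ℕ ℚ →ₐ[ℚ] MvPowerSeries ℕ ℚ :=
  MvPolynomial.aeval fun i => powerSum (i + 1)

/-- `D` is the sequence of coefficients of `exp (∑ f i t ^ (i + 1) / (i + 1))`. -/
def IsNewtonSeq {S : Type*} [CommRing S] (f D : ℕ → S) : Prop :=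
  D 0 = 1 ∧ ∀ n, D (n + 1) * (n + 1) = ∑ p ∈ antidiagonal n, f p.1 * D p.2

namespace IsNewtonSeq

variable {S : Type*} [CommRing S] {f g D E : ℕ → S}

theorem iff_derivative : IsNewtonSeq f D ↔ D 0 = 1 ∧
    PowerSeries.derivative S (PowerSeries.mk D) = PowerSeries.mk f * PowerSeries.mk D := by
  refine and_congr_right fun _ => ?_
  rw [PowerSeries.ext_iff]
  simp [PowerSeries.coeff_mul, PowerSeries.coeff_derivative]

/-- The exponential of a sum is the product of the exponentials; in terms of D' = fD this is the
Leibniz rule. -/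
theorem convolution (hD : IsNewtonSeq f D) (hE : IsNewtonSeq g E) :
    IsNewtonSeq (fun i => f i + g i)
      (fun n => ∑ p ∈ antidiagonal n, D p.1 * E p.2) := by
  have hmul : (PowerSeries.mk fun n => ∑ p ∈ antidiagonal n, D p.1 * E p.2) =
      PowerSeries.mk D * PowerSeries.mk E := by
    ext n
    simp [PowerSeries.coeff_mul]
  have hadd : (PowerSeries.mk fun i => f i + g i) = PowerSeries.mk f + PowerSeries.mk g := by
    ext n
    simp
  rw [iff_derivative] at *
  refine ⟨by simp [hD.1, hE.1], ?_⟩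
  rw [hmul, hadd, Derivation.leibniz, hD.2, hE.2, smul_eq_mul, smul_eq_mul]
  ring

theorem rescale (hD : IsNewtonSeq f D) (s : S) :
    IsNewtonSeq (fun i => s ^ (i + 1) * f i) (fun n => s ^ n * D n) := by
  refine ⟨by simp [hD.1], fun n => ?_⟩
  rw [mul_assoc, hD.2, Finset.mul_sum]
  refine Finset.sum_congr rfl fun p hp => ?_
  rw [← mem_antidiagonal.1 hp]
  ring

theorem map {T : Type*} [CommRing T] (φ : S →+* T) (hD : IsNewtonSeq f D) :
    IsNewtonSeq (fun i => φ (f i)) (fun n => φ (D n)) := by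
  refine ⟨by simp [hD.1], fun n => ?_⟩
  simpa using congrArg φ (hD.2 n)

theorem unique [Algebra ℚ S] (hD : IsNewtonSeq f D) (hE : IsNewtonSeq f E) (n : ℕ) :
    D n = E n := by
  induction n using Nat.strong_induction_on with
  | _ n ih =>
    cases n with
    | zero => rw [hD.1, hE.1]
    | succ n =>
      have hu : IsUnit ((n : S) + 1) := by
        have := (isUnit_iff_ne_zero.2 (Nat.cast_add_one_ne_zero (R := ℚ) n)).map (algebraMap ℚ S)
        simpa using this
      rw [← hu.mul_left_inj, hD.2, hE.2]
      refine Finset.sum_congr rfl fun p hp => ?_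
      have := mem_antidiagonal.1 hp
      rw [ih p.2 (by omega)]

end IsNewtonSeq

/-! ### Expansions in power sums -/

/-- The complete symmetric function `h_n`, as a polynomial in the power sums
(`X i` standing for `p_{i + 1}`). -/
noncomputable def completeInPowerSums : ℕ → MvPolynomial ℕ ℚ
  | 0 => 1
  | n + 1 => MvPolynomial.C ((n + 1 : ℚ)⁻¹) *
      ∑ i : Fin (n + 1), MvPolynomial.X (i : ℕ) * completeInPowerSums (n - i)

theorem isNewtonSeq_completeInPowerSums :
    IsNewtonSeq MvPolynomial.X completeInPowerSums := by
  refine ⟨by rw [completeInPowerSums], fun n => ?_⟩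
  rw [completeInPowerSums, Finset.Nat.sum_antidiagonal_eq_sum_range_succ_mk, mul_right_comm]
  have : (MvPolynomial.C ((n + 1 : ℚ)⁻¹) : MvPolynomial ℕ ℚ) * (n + 1) = 1 := by
    rw [← map_natCast MvPolynomial.C n, ← MvPolynomial.C_1, ← map_add, ← map_mul,
      inv_mul_cancel₀ (Nat.cast_add_one_ne_zero n)]
  rw [this, one_mul]
  exact Fin.sum_univ_eq_sum_range
    (fun i => MvPolynomial.X i * completeInPowerSums (n - i)) (n + 1)

/-- The size of the partition that has `e i` parts equal to `i + 1`. -/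
noncomputable abbrev partitionSize (e : ℕ →₀ ℕ) : ℕ := Finsupp.weight (fun i => i + 1) e

/-- These coefficients are the numbers 1/z_ν; only their sign and support are needed, and the
recurrence gives both. -/
theorem coeff_completeInPowerSums (n : ℕ) (e : ℕ →₀ ℕ) :
    (partitionSize e = n → 0 < (completeInPowerSums n).coeff e) ∧
    (partitionSize e ≠ n → (completeInPowerSums n).coeff e = 0) := by
  classical
  induction n using Nat.strong_induction_on generalizing e with
  | _ n ih =>
    cases n with
    | zero =>
      rw [isNewtonSeq_completeInPowerSums.1, MvPolynomial.coeff_one]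
      by_cases h : e = 0
      · simp [h]
      · rw [if_neg (Ne.symm h)]
        refine ⟨fun h' => absurd ?_ h, fun _ => rfl⟩
        have := Finsupp.nonTorsionWeight_of ℕ (w := fun i : ℕ => i + 1) fun i => Nat.succ_ne_zero i
        exact (Finsupp.weight_eq_zero_iff_eq_zero (w := fun i : ℕ => i + 1)).1 h'
    | succ n =>
      have hrec := congrArg (MvPolynomial.coeff e) (isNewtonSeq_completeInPowerSums.2 n)
      have hc : ((n : MvPolynomial ℕ ℚ) + 1) = MvPolynomial.C ((n : ℚ) + 1) := by simp
      rw [hc, mul_comm, MvPolynomial.coeff_C_mul, mul_comm, MvPolynomial.coeff_sum] at hrec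
      simp only [MvPolynomial.coeff_X_mul'] at hrec
      have hpos : (0 : ℚ) < n + 1 := by positivity
      have hsub : ∀ i ∈ e.support, partitionSize (e - Finsupp.single i 1) + (i + 1) =
          partitionSize e := fun i hi =>
        Finsupp.weight_sub_single_add (Finsupp.mem_support_iff.1 hi)
      constructor
      · intro he
        refine pos_of_mul_pos_left ?_ hpos.le
        rw [hrec]
        refine Finset.sum_pos' (fun p hp => ?_) ?_
        · rw [mem_antidiagonal] at hp
          split_ifs with hi
          · have := hsub _ hi
            exact ((ih p.2 (by omega) _).1 (by omega)).le
          · exact le_rfl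
        · have he0 : e ≠ 0 := by
            rintro rfl
            simp at he
          obtain ⟨i, hi⟩ := Finsupp.support_nonempty_iff.2 he0
          have := hsub i hi
          refine ⟨(i, n - i), mem_antidiagonal.2 (by dsimp only; omega), ?_⟩
          rw [if_pos hi]
          exact (ih _ (by dsimp only; omega) _).1 (by dsimp only; omega)
      · intro he
        refine (mul_eq_zero.1 ?_).resolve_right hpos.ne'
        rw [hrec]
        refine Finset.sum_eq_zero fun p hp => ?_
        rw [mem_antidiagonal] at hp
        split_ifs with hi
        · have := hsub _ hi
          exact (ih p.2 (by omega) _).2 (by omega)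
        · rfl

theorem coeff_aeval_C_mul_X {R : Type*} [CommRing R] [Algebra ℚ R] (a : ℕ → R)
    (P : MvPolynomial ℕ ℚ) (e : ℕ →₀ ℕ) :
    MvPolynomial.coeff e (MvPolynomial.aeval
      (fun i => (MvPolynomial.C (a i) * MvPolynomial.X i : MvPolynomial ℕ R)) P) =
      algebraMap ℚ R (P.coeff e) * e.prod fun i k => a i ^ k := by
  classical
  induction P using MvPolynomial.induction_on' with
  | monomial u c =>
    have : (u.prod fun i k => (MvPolynomial.C (a i) * MvPolynomial.X i : MvPolynomial ℕ R) ^ k) =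
        MvPolynomial.C (u.prod fun i k => a i ^ k) * MvPolynomial.monomial u 1 := by
      rw [MvPolynomial.monomial_eq, map_one, one_mul, Finsupp.prod, Finsupp.prod, Finsupp.prod,
        map_prod, ← Finset.prod_mul_distrib]
      simp only [mul_pow, map_pow]
    rw [MvPolynomial.aeval_monomial, this, MvPolynomial.algebraMap_apply,
      MvPolynomial.coeff_C_mul, MvPolynomial.coeff_C_mul, MvPolynomial.coeff_monomial,
      MvPolynomial.coeff_monomial]
    split_ifs with h
    · subst h
      simp
    · simp
  | add p q hp hq => rw [map_add, MvPolynomial.coeff_add, hp, hq, MvPolynomial.coeff_add, map_add,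
      add_mul]

/-- The one-row Schur `Q`-function, as a polynomial in the power sums. -/
noncomputable def rowPoly (n : ℕ) : MvPolynomial ℕ ℚ :=
  MvPolynomial.aeval (fun i => (MvPolynomial.C (oddWeight i) * MvPolynomial.X i :
    MvPolynomial ℕ ℚ)) (completeInPowerSums n)

theorem isNewtonSeq_rowPoly :
    IsNewtonSeq (fun i => MvPolynomial.C (oddWeight i) * MvPolynomial.X i) rowPoly := by
  have h := isNewtonSeq_completeInPowerSums.map (MvPolynomial.aeval
    (fun i => (MvPolynomial.C (oddWeight i) * MvPolynomial.X i : MvPolynomial ℕ ℚ))).toRingHom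
  simp only [AlgHom.toRingHom_eq_coe, RingHom.coe_coe, MvPolynomial.aeval_X] at h
  exact h

/-- Both sides satisfy the same Newton recurrence. As `c` is arbitrary, this also identifies row and
column functions. -/
theorem powerSumHom_rowPoly (c : Bool) (n : ℕ) : powerSumHom (rowPoly n) = chainSeries c n := by
  have h1 := isNewtonSeq_rowPoly.map powerSumHom.toRingHom
  refine IsNewtonSeq.unique h1 ⟨chainSeries_zero c, fun n => ?_⟩ n
  rw [chainSeries_newton]
  refine Finset.sum_congr rfl fun p _ => ?_
  simp [powerSumHom, Algebra.smul_def]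

/-- The generating function of the products of rows, in terms of the partition that has `e i` parts
equal to `i + 1`. -/
noncomputable def rowProductPoly (e : ℕ →₀ ℕ) : Polynomial ℚ :=
  e.prod fun i k => (Polynomial.C (oddWeight i) * (1 + Polynomial.X ^ (i + 1))) ^ k

/-- Weighting the first factor by a marker `X ^ k` makes ∑ X^k q_k q_{n-k} the image of h_n under
p_{i+1} ↦ w_i (1 + X^{i+1}) p_{i+1}, by uniqueness of Newton sequences; then coefficients of `X ^ k`
are compared. -/
theorem coeff_rowPoly_mul (e : ℕ →₀ ℕ) (n k : ℕ) (hk : k ≤ n) :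
    (rowPoly k * rowPoly (n - k)).coeff e =
      (completeInPowerSums n).coeff e * (rowProductPoly e).coeff k := by
  have h0 := isNewtonSeq_rowPoly.map (MvPolynomial.map (σ := ℕ) (Polynomial.C (R := ℚ)))
  have h1 := (h0.rescale (MvPolynomial.C Polynomial.X)).convolution h0
  have h2 := isNewtonSeq_completeInPowerSums.map (MvPolynomial.aeval (fun i =>
    (MvPolynomial.C (Polynomial.C (oddWeight i) * (1 + Polynomial.X ^ (i + 1))) * MvPolynomial.X i :
      MvPolynomial ℕ (Polynomial ℚ)))).toRingHom
  have hf : ∀ i, MvPolynomial.C Polynomial.X ^ (i + 1) *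
      MvPolynomial.map (σ := ℕ) (Polynomial.C (R := ℚ))
        (MvPolynomial.C (oddWeight i) * MvPolynomial.X i) +
      MvPolynomial.map (σ := ℕ) (Polynomial.C (R := ℚ))
        (MvPolynomial.C (oddWeight i) * MvPolynomial.X i) =
      (MvPolynomial.aeval (fun i =>
        (MvPolynomial.C (Polynomial.C (oddWeight i) * (1 + Polynomial.X ^ (i + 1))) *
          MvPolynomial.X i : MvPolynomial ℕ (Polynomial ℚ)))).toRingHom
        (MvPolynomial.X i : MvPolynomial ℕ ℚ) := by
    intro i
    simp
    ring
  simp only [hf] at h1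
  have h4 := congrArg (fun P => (MvPolynomial.coeff e P).coeff k) (IsNewtonSeq.unique h1 h2 n)
  simp only [AlgHom.toRingHom_eq_coe, RingHom.coe_coe, coeff_aeval_C_mul_X] at h4
  rw [Polynomial.algebraMap_eq, Polynomial.coeff_C_mul] at h4
  rw [rowProductPoly, ← h4, MvPolynomial.coeff_sum, Polynomial.finsetSum_coeff]
  have h5 : ∀ p ∈ antidiagonal n, (MvPolynomial.coeff e
      (MvPolynomial.C Polynomial.X ^ p.1 * MvPolynomial.map Polynomial.C (rowPoly p.1) *
        MvPolynomial.map Polynomial.C (rowPoly p.2))).coeff k =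
      if p.1 = k then (rowPoly p.1 * rowPoly p.2).coeff e else 0 := by
    intro p _
    rw [mul_assoc, ← map_mul, ← map_pow, MvPolynomial.coeff_C_mul, MvPolynomial.coeff_map,
      Polynomial.coeff_X_pow_mul']
    split_ifs with h6 h7 h7
    · subst h7
      simp
    · rw [Polynomial.coeff_C_of_ne_zero (by omega)]
    · omega
    · rfl
  rw [Finset.sum_congr rfl h5, Finset.Nat.sum_antidiagonal_eq_sum_range_succ_mk]
  simp [Nat.lt_succ_of_le hk]

/-- The triangle Schur `Q`-function of size `n` and column length `k`, as a polynomial in the power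
sums. -/
noncomputable def hookPoly (n : ℕ) : ℕ → MvPolynomial ℕ ℚ
  | 0 => 0
  | k + 1 => rowPoly k * rowPoly (n - k) - hookPoly n k

theorem ribbonTriangle_eq_powerSumHom (n k : ℕ) (h : k + 1 ≤ n) :
    ribbonTriangle n (k + 1) h = powerSumHom (hookPoly n (k + 1)) := by
  induction k with
  | zero =>
    rw [ribbonTriangle_one, hookPoly, hookPoly, isNewtonSeq_rowPoly.1, sub_zero, one_mul,
      Nat.sub_zero, powerSumHom_rowPoly]
  | succ k ih =>
    obtain ⟨a, rfl⟩ : ∃ a, n = (a + 1) + (k + 1) := ⟨n - (k + 2), by omega⟩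
    rw [hookPoly, map_sub, ← ih (by omega), map_mul, powerSumHom_rowPoly false, mul_comm,
      Nat.add_sub_cancel, powerSumHom_rowPoly true, chainSeries_mul, add_sub_cancel_left]

/-- The recursion of `hookPoly` is the one satisfied by the coefficients of a quotient by 1 + x. The
column length `k + 1` corresponds to the exponent `k`. -/
theorem coeff_hookPoly (e : ℕ →₀ ℕ) (n k : ℕ) (hk : k ≤ n) (G : PowerSeries ℚ)
    (hG : (1 + PowerSeries.X) * G = (rowProductPoly e : PowerSeries ℚ)) :
    (hookPoly n (k + 1)).coeff e = (completeInPowerSums n).coeff e * PowerSeries.coeff k G := by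
  induction k with
  | zero =>
    rw [hookPoly, hookPoly, sub_zero, coeff_rowPoly_mul e n 0 hk, ← Polynomial.coeff_coe, ← hG,
      add_mul, one_mul, map_add, PowerSeries.coeff_zero_X_mul, add_zero]
  | succ k ih =>
    rw [hookPoly, MvPolynomial.coeff_sub, ih (by omega), coeff_rowPoly_mul e n _ hk,
      ← Polynomial.coeff_coe, ← hG, add_mul, one_mul, map_add, PowerSeries.coeff_succ_X_mul]
    ring

theorem ribbonTriangle_congr {n n' k k' : ℕ} {h : k ≤ n} (hn : n = n') (hk : k = k') :
    ribbonTriangle n k h = ribbonTriangle n' k' (hn ▸ hk ▸ h) := by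
  subst hn hk
  rfl

/-- Exchanging row and column leaves the product of one-row functions unchanged, so r_{k+1} +
r_{k+2} = r_{n-k} + r_{n-k-1}; induction cancels the first terms. -/
theorem ribbonTriangle_symm (n k : ℕ) (h : k < n) :
    ribbonTriangle n (k + 1) h = ribbonTriangle n (n - k) (by omega) := by
  induction k with
  | zero =>
    rw [ribbonTriangle_one, ← powerSumHom_rowPoly, powerSumHom_rowPoly false,
      ← ribbonTriangle_self n h]
    rfl
  | succ k ih =>
    obtain ⟨a, rfl⟩ : ∃ a, n = (a + 1) + (k + 1) := ⟨n - (k + 2), by omega⟩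
    have h1 := chainSeries_mul a k
    have h2 := chainSeries_mul k a
    rw [← powerSumHom_rowPoly true, powerSumHom_rowPoly false, mul_comm,
      ← powerSumHom_rowPoly false, powerSumHom_rowPoly true, h1] at h2
    have h3 := ih (by omega)
    rw [ribbonTriangle_congr (add_comm (k + 1) (a + 1)) rfl,
      ribbonTriangle_congr (k := a + 2) (add_comm (k + 1) (a + 1)) rfl, h3,
      ribbonTriangle_congr (k := _ - k) rfl (show _ = a + 2 by omega), add_comm] at h2
    rw [ribbonTriangle_congr (k := _ - _) rfl (show _ = a + 1 by omega)]
    exact add_right_cancel h2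

/-! ### Algebraic independence of the power sums -/

/-- The multiset of the exponents of a monomial, each diminished by one. -/
noncomputable def exponentShape (d : ℕ →₀ ℕ) : Multiset ℕ := d.support.val.map fun i => d i - 1

/-- The power sum symmetric function whose parts are `i + 1` for `i` in a multiset. -/
noncomputable def powerSumMultiset (s : Multiset ℕ) : MvPowerSeries ℕ ℚ :=
  (s.map fun i => powerSum (i + 1)).prod

theorem powerSumMultiset_cons (a : ℕ) (s : Multiset ℕ) :
    powerSumMultiset (a ::ₘ s) = powerSum (a + 1) * powerSumMultiset s := by
  simp [powerSumMultiset]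

theorem exponentShape_cons {d d' : ℕ →₀ ℕ} {i a : ℕ} (hi : i ∉ d'.support)
    (hd : d = d' + Finsupp.single i (a + 1)) :
    d.support.card = d'.support.card + 1 ∧ exponentShape d = a ::ₘ exponentShape d' := by
  classical
  have hi' : d' i = 0 := Finsupp.notMem_support_iff.1 hi
  have hs : d.support = Finset.cons i d'.support hi := by
    ext j
    rw [hd, Finset.mem_cons, Finsupp.mem_support_iff, Finsupp.mem_support_iff, Finsupp.add_apply]
    by_cases h : j = i
    · simp [h]
    · simp [h]
  rw [exponentShape, hs, Finset.card_cons, Finset.cons_val, Multiset.map_cons]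
  refine ⟨rfl, ?_⟩
  congr 1
  · simp [hd, hi']
  · refine Multiset.map_congr rfl fun j hj => ?_
    have : j ≠ i := by
      rintro rfl
      exact hi hj
    simp [hd, this]

/-- Each factor contributes a power of one variable, so a monomial has at most as many variables as
there are factors; with equality the factors use distinct variables and the exponents are the parts.
-/
theorem coeff_powerSumMultiset (s : Multiset ℕ) (d : ℕ →₀ ℕ) :
    0 ≤ MvPowerSeries.coeff d (powerSumMultiset s) ∧
    (MvPowerSeries.coeff d (powerSumMultiset s) ≠ 0 → d.support.card ≤ s.card ∧
      (d.support.card = s.card → exponentShape d = s)) := by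
  classical
  induction s using Multiset.induction_on generalizing d with
  | empty =>
    rw [powerSumMultiset, Multiset.map_zero, Multiset.prod_zero, MvPowerSeries.coeff_one]
    split_ifs with h
    · simp [h, exponentShape]
    · simp
  | cons a s ih =>
    rw [powerSumMultiset_cons, coeff_powerSum_mul (Nat.add_one_pos a)]
    refine ⟨Finset.sum_nonneg fun i _ => ?_, fun hne => ?_⟩
    · split_ifs
      · exact (ih _).1
      · exact le_rfl
    · obtain ⟨i, hi, hne⟩ := Finset.exists_ne_zero_of_sum_ne_zero hne
      rw [ne_eq, ite_eq_right_iff, Classical.not_imp] at hne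
      obtain ⟨hle, hne⟩ := hne
      obtain ⟨h1, h2⟩ := (ih _).2 hne
      set d' := d - Finsupp.single i (a + 1) with hd'
      have hd : d = d' + Finsupp.single i (a + 1) :=
        (tsub_add_cancel_of_le (Finsupp.single_le_iff.2 hle)).symm
      rw [Multiset.card_cons]
      by_cases hi' : i ∈ d'.support
      · have hcard : d.support.card ≤ d'.support.card := by
          refine Finset.card_le_card fun j hj => ?_
          rw [hd, Finsupp.mem_support_iff, Finsupp.add_apply] at hj
          by_cases hji : j = i
          · rwa [hji]
          · rw [Finsupp.mem_support_iff]
            simpa [hji] using hj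
        exact ⟨by omega, fun h => by omega⟩
      · obtain ⟨h3, h4⟩ := exponentShape_cons hi' hd
        rw [h3, h4]
        exact ⟨by omega, fun h => by rw [h2 (by omega)]⟩

theorem exists_coeff_powerSumMultiset_pos (s : Multiset ℕ) :
    ∃ d : ℕ →₀ ℕ, d.support.card = s.card ∧ exponentShape d = s ∧
      0 < MvPowerSeries.coeff d (powerSumMultiset s) := by
  classical
  induction s using Multiset.induction_on with
  | empty => exact ⟨0, by simp [exponentShape, powerSumMultiset]⟩
  | cons a s ih =>
    obtain ⟨d, h1, h2, h3⟩ := ih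
    obtain ⟨i, hi⟩ := Infinite.exists_notMem_finset d.support
    obtain ⟨h4, h5⟩ := exponentShape_cons (a := a) hi rfl
    refine ⟨_, by rw [h4, h1, Multiset.card_cons], by rw [h5, h2], ?_⟩
    rw [powerSumMultiset_cons, coeff_powerSum_mul (Nat.add_one_pos a)]
    refine Finset.sum_pos' (fun j _ => ?_) ⟨i, ?_, ?_⟩
    · split_ifs
      · exact (coeff_powerSumMultiset s _).1
      · exact le_rfl
    · simp
    · rw [if_pos (by simp), add_tsub_cancel_right]
      exact h3

theorem powerSumHom_monomial (e : ℕ →₀ ℕ) (c : ℚ) :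
    powerSumHom (MvPolynomial.monomial e c) = c • powerSumMultiset e.toMultiset := by
  rw [powerSumHom, MvPolynomial.aeval_monomial, Algebra.smul_def, powerSumMultiset]
  congr 1
  rw [Finsupp.toMultiset_map, Finsupp.prod_toMultiset,
    Finsupp.prod_mapDomain_index (fun _ => pow_zero _) fun _ => pow_add _]

theorem powerSumHom_injective : Function.Injective powerSumHom := by
  rw [injective_iff_map_eq_zero]
  intro F hF
  by_contra hne
  -- With the number of parts maximal, a monomial giving every part its own variable comes from this
  -- term alone.
  obtain ⟨e, he, hmax⟩ := Finset.exists_max_image F.support (fun e => e.toMultiset.card)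
    (MvPolynomial.support_nonempty.2 hne)
  obtain ⟨d, h1, h2, h3⟩ := exists_coeff_powerSumMultiset_pos e.toMultiset
  have h4 := congrArg (MvPowerSeries.coeff d) hF
  rw [F.as_sum, map_sum, map_sum, map_zero, Finset.sum_eq_single e] at h4
  · rw [powerSumHom_monomial, MvPowerSeries.coeff_smul] at h4
    exact (mul_ne_zero (MvPolynomial.mem_support_iff.1 he) h3.ne') h4
  · intro e' he' hee'
    rw [powerSumHom_monomial, MvPowerSeries.coeff_smul, mul_eq_zero]
    right
    by_contra h5
    obtain ⟨h6, h7⟩ := (coeff_powerSumMultiset _ _).2 h5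
    have h8 := hmax e' he'
    have h9 := h7 (by omega)
    rw [h2] at h9
    exact hee' (by simpa using congrArg Multiset.toFinsupp h9.symm)
  · exact fun h => absurd he h

/-! ### The criterion for p-positivity -/

theorem isPPositive_zero : IsPPositive 0 := ⟨0, by simp, by simp⟩

theorem IsPPositive.add {f g : MvPowerSeries ℕ ℚ} (hf : IsPPositive f) (hg : IsPPositive g) :
    IsPPositive (f + g) := by
  obtain ⟨c, hc, rfl⟩ := hf
  obtain ⟨c', hc', rfl⟩ := hg
  refine ⟨c + c', fun nu => add_nonneg (hc nu) (hc' nu), ?_⟩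
  rw [Finsupp.sum_add_index'] <;> simp [add_smul]

theorem isPPositive_smul_powerSumMultiset (s : Multiset ℕ) (a : ℚ) (ha : 0 ≤ a) :
    IsPPositive (a • powerSumMultiset s) := by
  classical
  let nu : (s.map (· + 1)).sum.Partition :=
    { parts := s.map (· + 1)
      parts_pos := by
        intro i hi
        obtain ⟨j, _, rfl⟩ := Multiset.mem_map.1 hi
        exact Nat.succ_pos j
      parts_sum := rfl }
  refine ⟨Finsupp.single ⟨_, nu⟩ a, fun nu' => ?_, ?_⟩
  · rw [Finsupp.single_apply]
    split_ifs
    · exact ha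
    · exact le_rfl
  · refine Eq.trans ?_ (Finsupp.sum_single_index (zero_smul ℚ (powerSumPartition nu))).symm
    rw [powerSumPartition, powerSumMultiset, Multiset.map_map]
    rfl

theorem powerSumPartition_eq {m : ℕ} (nu : m.Partition) :
    powerSumPartition nu = powerSumMultiset (nu.parts.map (· - 1)) := by
  rw [powerSumPartition, powerSumMultiset, Multiset.map_map]
  refine congrArg Multiset.prod (Multiset.map_congr rfl fun i hi => ?_)
  have := nu.parts_pos hi
  rw [Function.comp_apply, Nat.sub_add_cancel this]

theorem isPPositive_powerSumHom_iff (F : MvPolynomial ℕ ℚ) :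
    IsPPositive (powerSumHom F) ↔ ∀ e, 0 ≤ F.coeff e := by
  classical
  constructor
  · rintro ⟨c, hc, hF⟩
    have h : F = c.sum fun nu a =>
        MvPolynomial.monomial (Multiset.toFinsupp (nu.2.parts.map (· - 1))) a := by
      apply powerSumHom_injective
      rw [hF, Finsupp.sum, Finsupp.sum, map_sum]
      refine Finset.sum_congr rfl fun nu _ => ?_
      rw [powerSumHom_monomial, powerSumPartition_eq, Multiset.toFinsupp_toMultiset]
    intro e
    rw [h, Finsupp.sum, MvPolynomial.coeff_sum]
    refine Finset.sum_nonneg fun nu _ => ?_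
    rw [MvPolynomial.coeff_monomial]
    split_ifs
    · exact hc nu
    · exact le_rfl
  · intro h
    rw [F.as_sum, map_sum]
    refine Finset.sum_induction _ IsPPositive (fun _ _ => IsPPositive.add) isPPositive_zero
      fun e _ => ?_
    rw [powerSumHom_monomial]
    exact isPPositive_smul_powerSumMultiset _ _ (h e)

/-- The series `G` is the quotient by 1 + x; quantifying over it lets each application supply the
quotient in a convenient form. -/
theorem isPPositive_ribbonTriangle_iff (n k : ℕ) (h : k + 1 ≤ n) :
    IsPPositive (ribbonTriangle n (k + 1) h) ↔ ∀ e, partitionSize e = n → ∀ G : PowerSeries ℚ,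
      (1 + PowerSeries.X) * G = (rowProductPoly e : PowerSeries ℚ) → 0 ≤ PowerSeries.coeff k G := by
  rw [ribbonTriangle_eq_powerSumHom, isPPositive_powerSumHom_iff]
  refine forall_congr' fun e => ?_
  by_cases he : partitionSize e = n
  · have hpos := (coeff_completeInPowerSums n e).1 he
    constructor
    · intro h1 _ G hG
      rw [coeff_hookPoly e n k (by omega) G hG] at h1
      exact nonneg_of_mul_nonneg_right h1 hpos
    · intro h1
      have hG : (1 + PowerSeries.X) * ((1 + PowerSeries.X : PowerSeries ℚ)⁻¹ *
          (rowProductPoly e : PowerSeries ℚ)) = (rowProductPoly e : PowerSeries ℚ) := by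
        rw [← mul_assoc, PowerSeries.mul_inv_cancel _ (by simp), one_mul]
      rw [coeff_hookPoly e n k (by omega) _ hG]
      exact mul_nonneg hpos.le (h1 he _ hG)
  · have hzero := (coeff_completeInPowerSums n e).2 he
    refine iff_of_true ?_ fun h => absurd h he
    have hG : (1 + PowerSeries.X) * ((1 + PowerSeries.X : PowerSeries ℚ)⁻¹ *
        (rowProductPoly e : PowerSeries ℚ)) = (rowProductPoly e : PowerSeries ℚ) := by
      rw [← mul_assoc, PowerSeries.mul_inv_cancel _ (by simp), one_mul]
    rw [coeff_hookPoly e n k (by omega) _ hG, hzero, zero_mul]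

/-! ### The p-positive cases -/

/-- The polynomials with nonnegative coefficients. -/
def nonnegCoeffSubmonoid : Submonoid (Polynomial ℚ) where
  carrier := {P | ∀ k, 0 ≤ P.coeff k}
  one_mem' k := by
    rw [Polynomial.coeff_one]
    split_ifs <;> norm_num
  mul_mem' {P Q} hP hQ k := by
    rw [Polynomial.coeff_mul]
    exact Finset.sum_nonneg fun p _ => mul_nonneg (hP _) (hQ _)

theorem oddWeight_nonneg (i : ℕ) : 0 ≤ oddWeight i := by
  unfold oddWeight
  split_ifs <;> norm_num

theorem rowProductPoly_coeff_nonneg (e : ℕ →₀ ℕ) (k : ℕ) : 0 ≤ (rowProductPoly e).coeff k := by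
  refine (Submonoid.prod_mem nonnegCoeffSubmonoid fun i _ => Submonoid.pow_mem _ (fun j => ?_) _ :
    rowProductPoly e ∈ nonnegCoeffSubmonoid) k
  rw [Polynomial.coeff_C_mul, Polynomial.coeff_add, Polynomial.coeff_one, Polynomial.coeff_X_pow]
  refine mul_nonneg (oddWeight_nonneg i) (add_nonneg ?_ ?_) <;> split_ifs <;> norm_num

/-- The polynomials without terms of degree one and two. -/
def gapSubmonoid : Submonoid (Polynomial ℚ) where
  carrier := {P | P.coeff 1 = 0 ∧ P.coeff 2 = 0}
  one_mem' := by simp [Polynomial.coeff_one]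
  mul_mem' {P Q} hP hQ := by
    simp only [Set.mem_ofPred_eq] at *
    simp [Polynomial.coeff_mul, Finset.Nat.antidiagonal_succ, hP, hQ]

/-- Parts equal to 1 are absent, parts equal to 2 have weight zero, and larger parts only involve
exponents at least 3. -/
theorem rowProductPoly_gap (e : ℕ →₀ ℕ) (he : e 0 = 0) :
    (rowProductPoly e).coeff 1 = 0 ∧ (rowProductPoly e).coeff 2 = 0 := by
  refine (Submonoid.prod_mem gapSubmonoid fun i hi => Submonoid.pow_mem _ ?_ _ :
    rowProductPoly e ∈ gapSubmonoid)
  have hi0 : i ≠ 0 := by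
    rintro rfl
    exact Finsupp.mem_support_iff.1 hi he
  show _ = _ ∧ _ = _
  rw [Polynomial.coeff_C_mul, Polynomial.coeff_C_mul]
  by_cases h1 : i = 1
  · subst h1
    simp [oddWeight]
  · simp [Polynomial.coeff_one, Polynomial.coeff_X_pow, show 2 ≠ i + 1 by omega, hi0]

theorem rowProductPoly_add (e e' : ℕ →₀ ℕ) :
    rowProductPoly (e + e') = rowProductPoly e * rowProductPoly e' :=
  Finsupp.prod_add_index' (fun _ => pow_zero _) fun _ => pow_add _

theorem rowProductPoly_single (i m : ℕ) : rowProductPoly (Finsupp.single i m) =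
    (Polynomial.C (oddWeight i) * (1 + Polynomial.X ^ (i + 1))) ^ m :=
  Finsupp.prod_single_index (pow_zero _)

theorem one_add_X_ne_zero : (1 + PowerSeries.X : PowerSeries ℚ) ≠ 0 := by
  intro h
  simpa using congrArg (PowerSeries.coeff 0) h

theorem coeff_zero_one_add_X_mul (G : PowerSeries ℚ) :
    PowerSeries.coeff 0 ((1 + PowerSeries.X) * G) = PowerSeries.coeff 0 G := by
  rw [add_mul, one_mul, map_add, PowerSeries.coeff_zero_X_mul, add_zero]

theorem coeff_succ_one_add_X_mul (G : PowerSeries ℚ) (n : ℕ) :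
    PowerSeries.coeff (n + 1) ((1 + PowerSeries.X) * G) =
      PowerSeries.coeff (n + 1) G + PowerSeries.coeff n G := by
  rw [add_mul, one_mul, map_add, PowerSeries.coeff_succ_X_mul]

theorem isPPositive_ribbonTriangle_one (n : ℕ) (h : 1 ≤ n) : IsPPositive (ribbonTriangle n 1 h) := by
  rw [isPPositive_ribbonTriangle_iff]
  intro e _ G hG
  rw [← coeff_zero_one_add_X_mul, hG, Polynomial.coeff_coe]
  exact rowProductPoly_coeff_nonneg e 0

theorem isPPositive_ribbonTriangle_three (n : ℕ) (h : 3 ≤ n) :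
    IsPPositive (ribbonTriangle n 3 h) := by
  rw [isPPositive_ribbonTriangle_iff]
  intro e _ G hG
  obtain ⟨h1, h2⟩ := rowProductPoly_gap (e.erase 0) Finsupp.erase_same
  have hpos := rowProductPoly_coeff_nonneg (e.erase 0)
  rw [← Finsupp.single_add_erase 0 e, rowProductPoly_add, rowProductPoly_single] at hG
  set B := rowProductPoly (e.erase 0)
  rcases Nat.eq_zero_or_pos (e 0) with h0 | h0
  · rw [h0, pow_zero, one_mul] at hG
    -- The product starts b + 0x + 0x², so the quotient starts b - bx + bx².
    have g0 := coeff_zero_one_add_X_mul G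
    have g1 := coeff_succ_one_add_X_mul G 0
    have g2 := coeff_succ_one_add_X_mul G 1
    rw [hG, Polynomial.coeff_coe] at g0 g1 g2
    have := hpos 0
    simp only [zero_add, Nat.reduceAdd] at g1 g2
    linarith
  · obtain ⟨m, hm⟩ : ∃ m, e 0 = m + 1 := ⟨e 0 - 1, by omega⟩
    -- One of the factors 1 + x coming from the parts 1 cancels the denominator.
    have hG' : G = ((Polynomial.C (2 ^ (m + 1)) * (1 + Polynomial.X) ^ m * B : Polynomial ℚ) :
        PowerSeries ℚ) := by
      apply mul_left_cancel₀ one_add_X_ne_zero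
      rw [hG, hm]
      simp [oddWeight, mul_pow]
      ring
    rw [hG', Polynomial.coeff_coe]
    refine (mul_mem (mul_mem (fun k => ?_) (pow_mem (fun k => ?_) m)) hpos :
      _ ∈ nonnegCoeffSubmonoid) 2
    · rw [Polynomial.coeff_C]
      split_ifs <;> positivity
    · rw [Polynomial.coeff_add, Polynomial.coeff_one, Polynomial.coeff_X]
      refine add_nonneg ?_ ?_ <;> split_ifs <;> norm_num

theorem isPPositive_ribbonTriangle_symm_iff (n k k' : ℕ) (hk : 1 ≤ k) (h : k ≤ n) (h' : k' ≤ n)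
    (hkk' : k + k' = n + 1) :
    IsPPositive (ribbonTriangle n k h) ↔ IsPPositive (ribbonTriangle n k' h') := by
  obtain ⟨j, rfl⟩ : ∃ j, k = j + 1 := ⟨k - 1, by omega⟩
  obtain rfl : k' = n - j := by omega
  rw [ribbonTriangle_symm n j h]

/-- The two middle functions agree by symmetry and add up to q_m², which is p-positive. -/
theorem isPPositive_ribbonTriangle_half (m : ℕ) (hm : 1 ≤ m) (h : m ≤ m + m) :
    IsPPositive (ribbonTriangle (m + m) m h) := by
  obtain ⟨j, rfl⟩ : ∃ j, m = j + 1 := ⟨m - 1, by omega⟩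
  have hs := ribbonTriangle_symm (j + 1 + (j + 1)) j (by omega)
  rw [ribbonTriangle_congr (k := _ - j) rfl (show _ = j + 1 + 1 by omega),
    ribbonTriangle_eq_powerSumHom, ribbonTriangle_eq_powerSumHom] at hs
  have hs := powerSumHom_injective hs
  rw [hookPoly.eq_2 _ (j + 1)] at hs
  rw [ribbonTriangle_eq_powerSumHom, isPPositive_powerSumHom_iff]
  intro e
  have h1 := congrArg (MvPolynomial.coeff e) hs
  rw [MvPolynomial.coeff_sub, coeff_rowPoly_mul e _ _ h] at h1
  have h2 := rowProductPoly_coeff_nonneg e (j + 1)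
  have h3 : 0 ≤ (completeInPowerSums (j + 1 + (j + 1))).coeff e := by
    by_cases he : partitionSize e = j + 1 + (j + 1)
    · exact ((coeff_completeInPowerSums _ e).1 he).le
    · exact ((coeff_completeInPowerSums _ e).2 he).ge
  have h4 := mul_nonneg h3 h2
  linarith

/-! ### The cases that are not p-positive -/

/-- The polynomial `2 * (1 - x + x ^ 2 - ⋯ + x ^ (2 * t))`. -/
noncomputable def alternatingSeries (t : ℕ) : PowerSeries ℚ :=
  PowerSeries.mk fun i => if i < 2 * t + 1 then 2 * (-1) ^ i else 0

theorem coeff_alternatingSeries (t i : ℕ) : PowerSeries.coeff i (alternatingSeries t) =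
    if i < 2 * t + 1 then 2 * (-1) ^ i else 0 :=
  PowerSeries.coeff_mk _ _

theorem rowProductPoly_odd (t : ℕ) :
    (rowProductPoly (Finsupp.single (2 * t) 1) : PowerSeries ℚ) =
      PowerSeries.C 2 * (1 + PowerSeries.X ^ (2 * t + 1)) := by
  rw [rowProductPoly_single]
  simp [oddWeight]

theorem one_add_X_mul_alternatingSeries (t : ℕ) :
    (1 + PowerSeries.X) * alternatingSeries t =
      (rowProductPoly (Finsupp.single (2 * t) 1) : PowerSeries ℚ) := by
  rw [rowProductPoly_odd]
  ext n
  rw [PowerSeries.coeff_C_mul, map_add, PowerSeries.coeff_one, PowerSeries.coeff_X_pow]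
  cases n with
  | zero =>
    rw [coeff_zero_one_add_X_mul, coeff_alternatingSeries]
    simp
  | succ n =>
    rw [coeff_succ_one_add_X_mul, coeff_alternatingSeries, coeff_alternatingSeries, pow_succ]
    rcases lt_trichotomy n (2 * t) with h | h | h
    · rw [if_pos (by omega), if_pos (by omega), if_neg (by omega), if_neg (by omega)]
      ring
    · subst h
      rw [if_neg (by omega), if_pos (by omega), if_neg (by omega), if_pos rfl, pow_mul]
      norm_num
    · rw [if_neg (by omega), if_neg (by omega), if_neg (by omega), if_neg (by omega)]
      ring

theorem coeff_rowProductPoly_odd_mul (t j : ℕ) (K : PowerSeries ℚ) :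
    PowerSeries.coeff j ((rowProductPoly (Finsupp.single (2 * t) 1) : PowerSeries ℚ) * K) =
      2 * (PowerSeries.coeff j K +
        if 2 * t + 1 ≤ j then PowerSeries.coeff (j - (2 * t + 1)) K else 0) := by
  rw [rowProductPoly_odd, mul_assoc, PowerSeries.coeff_C_mul, add_mul, one_mul, map_add,
    PowerSeries.coeff_X_pow_mul']

theorem coeff_alternatingSeries_nonpos (t i : ℕ) (hi : Odd i) :
    PowerSeries.coeff i (alternatingSeries t) ≤ 0 := by
  rw [coeff_alternatingSeries, hi.neg_one_pow]
  split_ifs <;> norm_num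

theorem partitionSize_single (i : ℕ) : partitionSize (Finsupp.single i 1) = i + 1 := by
  rw [partitionSize, Finsupp.weight_single, one_smul]

/-- One odd part `2 * t + 1` of the partition absorbs the division by 1 + x; `e` holds the remaining
parts. -/
theorem not_isPPositive_of_coeff_neg (n k t : ℕ) (h : k + 1 ≤ n) (e : ℕ →₀ ℕ)
    (he : partitionSize e + (2 * t + 1) = n)
    (hneg : PowerSeries.coeff k ((rowProductPoly e : PowerSeries ℚ) * alternatingSeries t) < 0) :
    ¬ IsPPositive (ribbonTriangle n (k + 1) h) := by
  rw [isPPositive_ribbonTriangle_iff]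
  intro hpos
  refine absurd (hpos (e + Finsupp.single (2 * t) 1) ?_ _ ?_) hneg.not_ge
  · rw [partitionSize, map_add, ← he]
    exact congrArg _ (partitionSize_single _)
  · rw [mul_left_comm, one_add_X_mul_alternatingSeries, rowProductPoly_add, Polynomial.coe_mul]

theorem not_isPPositive_one_part (t k : ℕ) (hk : Odd k) (h : k + 1 ≤ 2 * t + 1) :
    ¬ IsPPositive (ribbonTriangle (2 * t + 1) (k + 1) h) := by
  refine not_isPPositive_of_coeff_neg _ k t h 0 (by simp) ?_
  rw [show rowProductPoly 0 = 1 from Finsupp.prod_zero_index, Polynomial.coe_one, one_mul,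
    coeff_alternatingSeries, if_pos (by omega), hk.neg_one_pow]
  norm_num

theorem not_isPPositive_two_parts (n s t k : ℕ) (hk : Odd k) (hs : k < 2 * s + 1)
    (ht : k < 2 * t + 1) (hn : (2 * s + 1) + (2 * t + 1) = n) (h : k + 1 ≤ n) :
    ¬ IsPPositive (ribbonTriangle n (k + 1) h) := by
  refine not_isPPositive_of_coeff_neg n k t h (Finsupp.single (2 * s) 1)
    (by rw [partitionSize_single, hn]) ?_
  rw [coeff_rowProductPoly_odd_mul, if_neg (by omega), coeff_alternatingSeries, if_pos ht,
    hk.neg_one_pow]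
  norm_num

/-- Parts 2s+1, 2t+1, 3, the last divided by 1 + x to leave 2(1 - x + x²). The term x^{2s+1}·(-x)
hits x^k, and any contribution through x^{2t+1} alone has an odd cofactor degree, hence is not
positive. -/
theorem not_isPPositive_three_parts (n s t k : ℕ) (hs : 1 ≤ s) (ht : 1 ≤ t) (hk : k = 2 * s + 2)
    (hn : (2 * s + 1) + (2 * t + 1) + 3 = n) (h : k + 1 ≤ n) :
    ¬ IsPPositive (ribbonTriangle n (k + 1) h) := by
  refine not_isPPositive_of_coeff_neg n k 1 h (Finsupp.single (2 * s) 1 + Finsupp.single (2 * t) 1)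
    ?_ ?_
  · rw [partitionSize, map_add]
    have h1 := partitionSize_single (2 * s)
    have h2 := partitionSize_single (2 * t)
    rw [partitionSize] at h1 h2
    omega
  · have h1 : PowerSeries.coeff k (alternatingSeries 1) = 0 := by
      rw [coeff_alternatingSeries, if_neg (by omega)]
    have h2 : PowerSeries.coeff 1 (alternatingSeries 1) = -2 := by
      rw [coeff_alternatingSeries]
      norm_num
    have h3 : (if 2 * t + 1 ≤ k then
        PowerSeries.coeff (k - (2 * t + 1)) (alternatingSeries 1) else 0) ≤ 0 := by
      split_ifs
      · exact coeff_alternatingSeries_nonpos 1 _ (by rw [Nat.odd_iff]; omega)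
      · exact le_rfl
    rw [rowProductPoly_add, Polynomial.coe_mul, mul_assoc, coeff_rowProductPoly_odd_mul,
      if_pos (by omega), coeff_rowProductPoly_odd_mul, coeff_rowProductPoly_odd_mul,
      show k - (2 * s + 1) = 1 by omega, if_neg (show ¬ 2 * t + 1 ≤ 1 by omega), h1, h2]
    linarith

/-- As with three parts, plus another 3 to fix the parity of `n`. Its factor x³ leaves the odd
degree k - 3, and `k < 2 * t + 4` keeps x^{2t+1}·x³ out of reach. -/
theorem not_isPPositive_four_parts (n s t k : ℕ) (hs : 1 ≤ s) (ht : 1 ≤ t) (hk : k = 2 * s + 2)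
    (hkt : k < 2 * t + 4) (hn : (2 * s + 1) + (2 * t + 1) + 6 = n) (h : k + 1 ≤ n) :
    ¬ IsPPositive (ribbonTriangle n (k + 1) h) := by
  refine not_isPPositive_of_coeff_neg n k 1 h
    (Finsupp.single (2 * s) 1 + (Finsupp.single (2 * t) 1 + Finsupp.single (2 * 1) 1)) ?_ ?_
  · rw [partitionSize, map_add, map_add]
    have h1 := partitionSize_single (2 * s)
    have h2 := partitionSize_single (2 * t)
    have h3 := partitionSize_single (2 * 1)
    rw [partitionSize] at h1 h2 h3
    omega
  · have h1 : PowerSeries.coeff k (alternatingSeries 1) = 0 := by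
      rw [coeff_alternatingSeries, if_neg (by omega)]
    have h2 : PowerSeries.coeff 1 (alternatingSeries 1) = -2 := by
      rw [coeff_alternatingSeries]
      norm_num
    have h3 := coeff_alternatingSeries_nonpos 1 (k - (2 * 1 + 1)) (by rw [Nat.odd_iff]; omega)
    have h4 : (if 2 * t + 1 ≤ k then PowerSeries.coeff (k - (2 * t + 1))
        ((rowProductPoly (Finsupp.single (2 * 1) 1) : PowerSeries ℚ) * alternatingSeries 1)
        else 0) ≤ 0 := by
      split_ifs
      · rw [coeff_rowProductPoly_odd_mul, if_neg (by omega)]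
        have := coeff_alternatingSeries_nonpos 1 (k - (2 * t + 1)) (by rw [Nat.odd_iff]; omega)
        linarith
      · exact le_rfl
    rw [rowProductPoly_add, rowProductPoly_add, Polynomial.coe_mul, Polynomial.coe_mul, mul_assoc,
      mul_assoc, coeff_rowProductPoly_odd_mul, if_pos (by omega),
      show k - (2 * s + 1) = 1 by omega, coeff_rowProductPoly_odd_mul t k,
      coeff_rowProductPoly_odd_mul t 1, if_neg (show ¬ 2 * t + 1 ≤ 1 by omega),
      coeff_rowProductPoly_odd_mul 1 k, coeff_rowProductPoly_odd_mul 1 1,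
      if_pos (show 2 * 1 + 1 ≤ k by omega), if_neg (show ¬ 2 * 1 + 1 ≤ 1 by omega), h1, h2]
    linarith

theorem isPPositive_ribbonTriangle_self (n : ℕ) (h : 1 ≤ n) :
    IsPPositive (ribbonTriangle n n le_rfl) :=
  (isPPositive_ribbonTriangle_symm_iff n n 1 h le_rfl h rfl).2 (isPPositive_ribbonTriangle_one n h)

theorem isPPositive_ribbonTriangle_sub_two (n : ℕ) (h : 3 ≤ n) :
    IsPPositive (ribbonTriangle n (n - 2) (Nat.sub_le n 2)) :=
  (isPPositive_ribbonTriangle_symm_iff n (n - 2) 3 (by omega) _ h (by omega)).2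
    (isPPositive_ribbonTriangle_three n h)

theorem not_isPPositive_of_odd (n k : ℕ) (hn : Odd n) (hk : 1 ≤ k) (h : k ≤ n) (h1 : k ≠ 1)
    (h3 : k ≠ 3) (hn2 : k ≠ n - 2) (hkn : k ≠ n) : ¬ IsPPositive (ribbonTriangle n k h) := by
  obtain ⟨j, rfl⟩ : ∃ j, k = j + 1 := ⟨k - 1, by omega⟩
  rw [Nat.odd_iff] at hn
  rcases Nat.even_or_odd j with hj | hj
  · rw [Nat.even_iff] at hj
    -- The parts are j-1, n-j-2 and 3.
    exact not_isPPositive_three_parts n ((j - 2) / 2) ((n - 3 - j) / 2) j (by omega) (by omega)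
      (by omega) (by omega) h
  · obtain ⟨t, rfl⟩ : ∃ t, n = 2 * t + 1 := ⟨n / 2, by omega⟩
    exact not_isPPositive_one_part t j hj h

theorem not_isPPositive_of_even (n k : ℕ) (hn : Even n) (hk : 1 ≤ k) (h : k ≤ n) (h1 : k ≠ 1)
    (h3 : k ≠ 3) (hlt : k < n / 2) : ¬ IsPPositive (ribbonTriangle n k h) := by
  obtain ⟨j, rfl⟩ : ∃ j, k = j + 1 := ⟨k - 1, by omega⟩
  rw [Nat.even_iff] at hn
  rcases Nat.even_or_odd j with hj | hj
  · rw [Nat.even_iff] at hj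
    -- The parts are j-1, n-j-5, 3 and 3.
    exact not_isPPositive_four_parts n ((j - 2) / 2) ((n - 6 - j) / 2) j (by omega) (by omega)
      (by omega) (by omega) (by omega) h
  · have hj' := Nat.odd_iff.1 hj
    -- The parts are j+2 and n-j-2, both larger than `j` because `j + 1 < n / 2`.
    exact not_isPPositive_two_parts n ((j + 1) / 2) ((n - j - 3) / 2) j hj (by omega) (by omega)
      (by omega) h

theorem mainTheorem2 (n k : ℕ) (hk : 1 ≤ k) (hkn : k ≤ n) :
    (n ≤ 2 → IsPPositive (ribbonTriangle n k hkn)) ∧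
    (Odd n → 3 ≤ n →
      (IsPPositive (ribbonTriangle n k hkn) ↔ k ∈ ({1, 3, n - 2, n} : Set ℕ))) ∧
    (Even n → 4 ≤ n →
      (IsPPositive (ribbonTriangle n k hkn) ↔
        k ∈ ({1, 3, n / 2, n / 2 + 1, n - 2, n} : Set ℕ))) := by
  simp only [Set.mem_insert_iff, Set.mem_singleton_iff]
  refine ⟨fun hn => ?_, fun hodd hn => ⟨fun hpos => ?_, ?_⟩, fun heven hn => ⟨fun hpos => ?_, ?_⟩⟩
  · rcases (show k = 1 ∨ k = n by omega) with rfl | rfl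
    · exact isPPositive_ribbonTriangle_one n hkn
    · exact isPPositive_ribbonTriangle_self k hk
  · by_contra! hnot
    exact not_isPPositive_of_odd n k hodd hk hkn hnot.1 hnot.2.1 hnot.2.2.1 hnot.2.2.2 hpos
  · rintro (rfl | rfl | rfl | rfl)
    · exact isPPositive_ribbonTriangle_one n hkn
    · exact isPPositive_ribbonTriangle_three n hkn
    · exact isPPositive_ribbonTriangle_sub_two n hn
    · exact isPPositive_ribbonTriangle_self k hk
  · by_contra! hnot
    have he := Nat.even_iff.1 heven
    rcases lt_or_ge k (n / 2) with hlt | hge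
    · exact not_isPPositive_of_even n k heven hk hkn hnot.1 hnot.2.1 hlt hpos
    -- Since `k` is neither `n / 2` nor `n / 2 + 1`, its reflection `n + 1 - k` lies below `n / 2`.
    · rw [isPPositive_ribbonTriangle_symm_iff n k (n + 1 - k) hk hkn (by omega) (by omega)] at hpos
      exact not_isPPositive_of_even n (n + 1 - k) heven (by omega) (by omega) (by omega) (by omega)
        (by omega) hpos
  · obtain ⟨m, rfl⟩ := heven
    have hm : (m + m) / 2 = m := by omega
    rw [hm]
    rintro (rfl | rfl | rfl | rfl | rfl | rfl)
    · exact isPPositive_ribbonTriangle_one _ hkn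
    · exact isPPositive_ribbonTriangle_three _ hkn
    · exact isPPositive_ribbonTriangle_half k hk hkn
    · exact (isPPositive_ribbonTriangle_symm_iff (m + m) m (m + 1) (by omega) (by omega) hkn
        (by omega)).1 (isPPositive_ribbonTriangle_half m (by omega) (by omega))
    · exact isPPositive_ribbonTriangle_sub_two _ (by omega)
    · exact isPPositive_ribbonTriangle_self _ hk
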